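/- For a finite poset $P$, a presentation order is a linear order $v_1\prec\dots\prec v_n$ of its vertices. An on-line chain partitioning algorithm $\mathcal A$ is a deterministic rule that, for every finite poset $P$ and every presentation order of $P$, assigns the vertices one at a time to disjoint chains $C_1,C_2,\dots$, where the chain to which $v_i$ is assigned is determined solely by the subposet induced by $v_1,\dots,v_i$ together with their order of presentation. Let $\chi_{\mathcal A}(P)$ be the maximum, over all presentation orders of $P$, of the number of nonempty chains that $\mathcal A$ uses, and for a class $\mathcal P$ of finite posets let $\operatorname{val}(\mathcal P)=\min_{\mathcal A}\max_{P\in\mathcal P}\chi_{\mathcal A}(P)$, where the minimum is over all on-line chain partitioning algorithms $\mathcal A$ (and the value is $\infty$ if no algorithm is bounded on $\mathcal P$). Let $\mathcal P_w$ be the class of finite posets of width $w$ (the largest antichain has exactly $w$ elements). Then $$\operatorname{val}(\mathcal P_w)\le w^{6.5\lg w+O(1)},$$ where $\lg=\log_2$; that is, there is an absolute constant $C$ such that $\operatorname{val}(\mathcal P_w)\le w^{6.5\lg w+C}$ for every integer $w\ge 1$. -/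

import Mathlib

open scoped ENNReal

universe u

namespace OnlineChain

/-- The width of a poset: the largest size of an antichain. -/
noncomputable def width (V : Type u) [PartialOrder V] : ℕ∞ :=
  ⨆ (S : Set V) (_ : IsAntichain (· ≤ ·) S), S.encard

/-- A presentation order `v 0 ≺ v 1 ≺ ⋯ ≺ v (n - 1)` of the finite set `V`, given by listing
the vertices in the order in which they are presented. -/
structure Presentation (V : Type u) where
  /-- the number of vertices -/
  n : ℕ
  /-- the list of the vertices, each occurring exactly once -/
  v : Fin n ≃ V

/-- The subposet induced by the vertices `v 0, …, v i` that are presented up to time `i`,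
each of them labelled by its position in the presentation order. -/
abbrev Presentation.upTo {V : Type u} [PartialOrder V] (p : Presentation V) (i : Fin p.n) :
    PartialOrder (Fin (i.val + 1)) :=
  PartialOrder.lift (fun j => p.v (Fin.castLE i.isLt j))
    (p.v.injective.comp (Fin.castLE_injective i.isLt))

/-- A deterministic on-line rule: from the on-line poset formed by the `i + 1` vertices
presented so far (the `j`-th of which is labelled `j`), it determines the index of the chain to
which the vertex presented last, the one labelled `i`, is assigned. -/
abbrev Rule : Type := (i : ℕ) → PartialOrder (Fin (i + 1)) → ℕ

/-- The index of the chain to which the rule `A` assigns the vertex `x`, when the vertices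
of `V` are presented in the order `p`. -/
def Rule.index (A : Rule) {V : Type u} [PartialOrder V] (p : Presentation V) (x : V) : ℕ :=
  A (p.v.symm x) (p.upTo (p.v.symm x))

/-- An on-line chain partitioning algorithm: an on-line rule such that on every finite on-line
poset all vertices that are assigned the same index form a chain. -/
structure Algorithm : Type where
  /-- the underlying rule -/
  rule : Rule
  /-- the vertices of every finite on-line poset are assigned to chains -/
  isChain : ∀ (V : Type u) [PartialOrder V] (p : Presentation V) (c : ℕ),
    IsChain (· ≤ ·) {x : V | rule.index p x = c}

/-- The number of nonempty chains that `A` uses on a poset presented in the order `p`. -/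
noncomputable def Algorithm.chiOn (A : Algorithm.{u}) {V : Type u} [PartialOrder V]
    (p : Presentation V) : ℕ∞ :=
  (Set.range (A.rule.index p)).encard

/-- The maximum number of chains that `A` uses on `V`, over all presentation orders. -/
noncomputable def Algorithm.chi (A : Algorithm.{u}) (V : Type u) [PartialOrder V] : ℕ∞ :=
  ⨆ p : Presentation V, A.chiOn p

/-- The maximum number of chains that `A` uses on a poset of the class `K`; it is `⊤` if
this number is unbounded. -/
noncomputable def Algorithm.val (A : Algorithm.{u}) (K : Set FinPartOrd.{u}) : ℕ∞ :=
  ⨆ P ∈ K, A.chi P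

/-- The on-line chain partitioning value of the class `K`: the minimum of `A.val K` over all
on-line chain partitioning algorithms `A`. -/
noncomputable def val (K : Set FinPartOrd.{u}) : ℕ∞ :=
  ⨅ A : Algorithm.{u}, A.val K

/-- The class of finite posets of width `w`. -/
def posetsOfWidth (w : ℕ) : Set FinPartOrd.{u} :=
  {P | width P = w}

end OnlineChain

/-!
The vertices are distributed among antichains on-line, and First-Fit is run on copies of the
vertices in which all ladders are short.

*Antichains.* Each presented vertex `v` gets the least number `k` such that, for all `k' ≥ k`, the
vertices of level at most `k'` so far, together with `v`, have width at most `k'`. Then `v` lies in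
an antichain of size `k` that is maximum among the vertices of level at most `k`. Joins and meets
of maximum antichains are maximum antichains, so the antichain of `v` can be chosen comparable to
all previous antichains of size `k` (`exists_isGood`). Hence the antichains of size `k` are linearly
ordered; they are the levels of a level system, in which each level has its own copies of its
vertices.

*Sparse comparabilities.* Between two levels only those comparabilities are kept that lie in a
perfect matching of comparable pairs. When a level is inserted, it is related in this way to its
two neighbours, and to all other levels by composition (`Link`). The result is an order whose
relation between two levels never changes later (`IsLevelSystem.link_trans`), in which each edge
lies in a perfect matching (`IsLevelSystem.link_matching`), and in which edges that cross
a level older than all levels between it and their upper end factor through that level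
(`IsLevelSystem.link_interpolate`). By Hall's theorem and composition of matchings this order is
covered by `k` chains, and the last property implies that its ladders have at most `2 k²` rungs
(`Node.card_ladder_le`).

*First-Fit.* On a poset covered by `w` chains in which every ladder has at most `m` rungs,
First-Fit uses at most `(w - 1) (32 w³ m) ^ j` positive colours if `w < 2 ^ j`
(`firstFit_color_le`). This is proved for the colours on a chain `Y` by induction on the logarithm
of the width of its convex hull. Of two mutually incomparable chains in the hull one has at most
half the width, hence few colours. If `Y` is long, shortness of ladders yields a long piece of `Y`
that no element incomparable to the ends of `Y` separates, and there the First-Fit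
property produces an antichain of more than `w` elements.

A vertex is assigned to the chain given by the size of its antichain and by the colour of its own
copy. With `m = 2 k²` and `j = ⌊lg w⌋ + 1` the number of chains is
`w · ((w - 1) (64 w⁵) ^ j + 1)`, which is at most `w ^ (5 lg w + O(1))`.
-/

namespace OnlineChain

/-! ### First-Fit on posets without long ladders -/

section FirstFit

open scoped Classical

variable {X : Type*} [PartialOrder X]

/-- Two elements of a poset are incomparable. -/
abbrev Incomp (x y : X) : Prop := IncompRel (· ≤ ·) x y

/-- The convex hull of a finite set in a poset. -/
def hull (Y : Finset X) : Set X := {z | (∃ a ∈ Y, a ≤ z) ∧ ∃ b ∈ Y, z ≤ b}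

/-- A ladder, given by the finite set of its rungs: each rung `p` goes from the element `p.1` of
the lower leg up to the element `p.2` of the upper leg, both legs are chains, and an element of
the lower leg is incomparable to the upper ends of all rungs before it. -/
def IsLadder (T : Finset (X × X)) : Prop :=
  (∀ p ∈ T, p.1 < p.2) ∧ ∀ p ∈ T, ∀ q ∈ T, p ≠ q →
    (p.1 < q.1 ∧ p.2 < q.2 ∧ Incomp q.1 p.2) ∨ (q.1 < p.1 ∧ q.2 < p.2 ∧ Incomp p.1 q.2)

lemma exists_greatest_of_isChain {Y : Finset X} (hY : IsChain (· ≤ ·) (Y : Set X))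
    (hne : Y.Nonempty) : ∃ t ∈ Y, ∀ y ∈ Y, y ≤ t := by
  obtain ⟨t, ht⟩ := Y.exists_maximal hne
  refine ⟨t, ht.1, fun y hy => ?_⟩
  rcases hY.total hy ht.1 with h | h
  · exact h
  · exact ht.2 hy h

lemma exists_least_of_isChain {Y : Finset X} (hY : IsChain (· ≤ ·) (Y : Set X))
    (hne : Y.Nonempty) : ∃ t ∈ Y, ∀ y ∈ Y, t ≤ y :=
  exists_greatest_of_isChain (X := Xᵒᵈ) hY.symm hne

lemma card_filter_card_le {B : Finset X} (hB : IsChain (· ≤ ·) (B : Set X)) (β : ℕ) :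
    {b ∈ B | {a ∈ B | a ≤ b}.card ≤ β}.card ≤ β := by
  rcases Finset.eq_empty_or_nonempty {b ∈ B | {a ∈ B | a ≤ b}.card ≤ β} with h | h
  · simp [h]
  · obtain ⟨t, ht, hmax⟩ := exists_greatest_of_isChain
      (hB.mono (Finset.coe_subset.2 (Finset.filter_subset _ _))) h
    refine le_trans (Finset.card_le_card fun b hb => ?_) (Finset.mem_filter.1 ht).2
    exact Finset.mem_filter.2 ⟨(Finset.mem_filter.1 hb).1, hmax b hb⟩

lemma card_filter_card_ge {B : Finset X} (hB : IsChain (· ≤ ·) (B : Set X)) (β : ℕ) :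
    {b ∈ B | {a ∈ B | b ≤ a}.card ≤ β}.card ≤ β :=
  card_filter_card_le (X := Xᵒᵈ) hB.symm β

/-- Discarding the `β` lowest and the `β` highest elements of a chain. -/
lemma card_middle {B : Finset X} (hB : IsChain (· ≤ ·) (B : Set X)) (β : ℕ) :
    B.card ≤ {b ∈ B | β < {a ∈ B | a ≤ b}.card ∧ β < {a ∈ B | b ≤ a}.card}.card + 2 * β := by
  have h1 := card_filter_card_le hB β
  have h2 := card_filter_card_ge hB β
  have h3 : B ⊆ {b ∈ B | β < {a ∈ B | a ≤ b}.card ∧ β < {a ∈ B | b ≤ a}.card} ∪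
      ({b ∈ B | {a ∈ B | a ≤ b}.card ≤ β} ∪ {b ∈ B | {a ∈ B | b ≤ a}.card ≤ β}) := by
    intro b hb
    simp only [Finset.mem_union, Finset.mem_filter, hb, true_and]
    omega
  have h4 := Finset.card_le_card h3
  have h5 := Finset.card_union_le {b ∈ B | β < {a ∈ B | a ≤ b}.card ∧ β < {a ∈ B | b ≤ a}.card}
      ({b ∈ B | {a ∈ B | a ≤ b}.card ≤ β} ∪ {b ∈ B | {a ∈ B | b ≤ a}.card ≤ β})
  have h6 := Finset.card_union_le {b ∈ B | {a ∈ B | a ≤ b}.card ≤ β}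
    {b ∈ B | {a ∈ B | b ≤ a}.card ≤ β}
  omega

/-- The elements of a chain `Y` that are the largest elements of `Y` below some `z`
incomparable to the top of `Y`. The elements `z` of one chain of the cover that
have distinct thresholds are the upper leg of a ladder. -/
lemma card_threshold_le {w m : ℕ} {cov : X → Fin w}
    (hcov : ∀ x y, cov x = cov y → x ≤ y ∨ y ≤ x)
    (hlad : ∀ T : Finset (X × X), IsLadder T → T.card ≤ m)
    {Y : Finset X} (hY : IsChain (· ≤ ·) (Y : Set X)) {t : X} (ht : ∀ y ∈ Y, y ≤ t) :
    {θ ∈ Y | ∃ z, Incomp z t ∧ θ < z ∧ ∀ y ∈ Y, y < z → y ≤ θ}.card ≤ w * m := by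
  by_contra! hcon
  set Θ := {θ ∈ Y | ∃ z, Incomp z t ∧ θ < z ∧ ∀ y ∈ Y, y < z → y ≤ θ} with hΘ
  have hz : ∀ θ, ∃ z, θ ∈ Θ → Incomp z t ∧ θ < z ∧ ∀ y ∈ Y, y < z → y ≤ θ := by
    intro θ
    by_cases h : θ ∈ Θ
    · obtain ⟨z, hz⟩ := (Finset.mem_filter.1 h).2
      exact ⟨z, fun _ => hz⟩
    · exact ⟨θ, fun h' => absurd h' h⟩
  choose z hz using hz
  obtain ⟨l, -, hl⟩ := Finset.exists_lt_card_fiber_of_mul_lt_card_of_maps_to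
    (s := Θ) (t := (Finset.univ : Finset (Fin w))) (f := fun θ => cov (z θ)) (n := m)
    (fun _ _ => Finset.mem_univ _) (by simpa using hcon)
  set F := {θ ∈ Θ | cov (z θ) = l} with hF
  have hinj : Function.Injective (fun θ => (θ, z θ)) := fun a b h => congrArg Prod.fst h
  have hcard := hlad (F.image fun θ => (θ, z θ)) ?_
  · rw [Finset.card_image_of_injective _ hinj] at hcard
    omega
  have key : ∀ a ∈ F, ∀ b ∈ F, a < b → a < b ∧ z a < z b ∧ Incomp b (z a) := by
    intro a ha b hb hab
    obtain ⟨haΘ, hal⟩ := Finset.mem_filter.1 ha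
    obtain ⟨hbΘ, hbl⟩ := Finset.mem_filter.1 hb
    have haY := (Finset.mem_filter.1 haΘ).1
    have hbY := (Finset.mem_filter.1 hbΘ).1
    obtain ⟨ha1, ha2, ha3⟩ := hz a haΘ
    obtain ⟨hb1, hb2, hb3⟩ := hz b hbΘ
    have hnb : ¬ b < z a := fun h => absurd (ha3 b hbY h) (not_le_of_gt hab)
    refine ⟨hab, ?_, ?_⟩
    · rcases hcov _ _ (hal.trans hbl.symm) with h | h
      · rcases h.lt_or_eq with h | h
        · exact h
        · exact absurd (h ▸ hb2) hnb
      · exact absurd (hb2.trans_le h) hnb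
    · refine ⟨fun h => ?_, fun h => ha1.1 (h.trans (ht b hbY))⟩
      rcases h.lt_or_eq with h | h
      · exact hnb h
      · exact ha1.1 (h ▸ ht b hbY)
  refine ⟨?_, ?_⟩
  · intro p hp
    obtain ⟨a, ha, rfl⟩ := Finset.mem_image.1 hp
    exact (hz a (Finset.mem_filter.1 ha).1).2.1
  · intro p hp q hq hpq
    obtain ⟨a, ha, rfl⟩ := Finset.mem_image.1 hp
    obtain ⟨b, hb, rfl⟩ := Finset.mem_image.1 hq
    have hab : a ≠ b := fun h => hpq (by rw [h])
    have haY := (Finset.mem_filter.1 (Finset.mem_filter.1 ha).1).1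
    have hbY := (Finset.mem_filter.1 (Finset.mem_filter.1 hb).1).1
    rcases hY.total haY hbY with h | h
    · exact Or.inl (key a ha b hb (lt_of_le_of_ne h hab))
    · exact Or.inr (key b hb a ha (lt_of_le_of_ne h hab.symm))

lemma isLadder_dual {T : Finset (Xᵒᵈ × Xᵒᵈ)} (hT : IsLadder T) :
    IsLadder (X := X) (T.image fun p => (OrderDual.ofDual p.2, OrderDual.ofDual p.1)) := by
  refine ⟨?_, ?_⟩
  · intro p hp
    obtain ⟨a, ha, rfl⟩ := Finset.mem_image.1 hp
    exact hT.1 a ha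
  · intro p hp q hq hpq
    obtain ⟨a, ha, rfl⟩ := Finset.mem_image.1 hp
    obtain ⟨b, hb, rfl⟩ := Finset.mem_image.1 hq
    have hab : a ≠ b := fun h => hpq (by rw [h])
    rcases hT.2 a ha b hb hab with h | h
    · exact Or.inr ⟨h.2.1, h.1, h.2.2⟩
    · exact Or.inl ⟨h.2.1, h.1, h.2.2⟩

lemma card_ladder_dual_le {m : ℕ} (hlad : ∀ T : Finset (X × X), IsLadder T → T.card ≤ m)
    (T : Finset (Xᵒᵈ × Xᵒᵈ)) (hT : IsLadder T) : T.card ≤ m := by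
  have h := hlad _ (isLadder_dual hT)
  rwa [Finset.card_image_of_injective] at h
  intro a b hab
  exact Prod.ext (congrArg Prod.snd hab) (congrArg Prod.fst hab)

/-- A long chain `Y` contains a large block `B` that is not separated by any element incomparable
to the top or to the bottom of `Y`. -/
lemma exists_block {w m s : ℕ} {cov : X → Fin w}
    (hcov : ∀ x y, cov x = cov y → x ≤ y ∨ y ≤ x)
    (hlad : ∀ T : Finset (X × X), IsLadder T → T.card ≤ m)
    {Y : Finset X} (hY : IsChain (· ≤ ·) (Y : Set X)) {t b : X} (ht : ∀ y ∈ Y, y ≤ t)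
    (hb : ∀ y ∈ Y, b ≤ y) (hs : (2 * (w * m) + 1) * s < Y.card) :
    ∃ B ⊆ Y, s < B.card ∧
      (∀ z, Incomp z t → ∀ x ∈ B, x < z → ∀ y ∈ B, y < z) ∧
      (∀ z, Incomp z b → ∀ x ∈ B, z < x → ∀ y ∈ B, z < y) := by
  set Θ := {θ ∈ Y | ∃ z, Incomp z t ∧ θ < z ∧ ∀ y ∈ Y, y < z → y ≤ θ} with hΘ
  set Ψ := {θ ∈ Y | ∃ z, Incomp z b ∧ z < θ ∧ ∀ y ∈ Y, z < y → θ ≤ y} with hΨ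
  have hΘc : Θ.card ≤ w * m := card_threshold_le hcov hlad hY ht
  have hΨc : Ψ.card ≤ w * m :=
    (Finset.card_le_card fun θ hθ => Finset.mem_filter.2 ⟨(Finset.mem_filter.1 hθ).1,
      (Finset.mem_filter.1 hθ).2.imp fun z hz => ⟨hz.1.symm, hz.2⟩⟩).trans
    (card_threshold_le (X := Xᵒᵈ) (cov := cov) (fun x y h => (hcov x y h).symm)
      (card_ladder_dual_le hlad) hY.symm hb)
  set c : X → ℕ := fun y => {θ ∈ Θ | θ < y}.card + {θ ∈ Ψ | θ ≤ y}.card with hc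
  have hcm1 : ∀ x y, x ≤ y → {θ ∈ Θ | θ < x} ⊆ {θ ∈ Θ | θ < y} := fun x y hxy θ hθ =>
    Finset.mem_filter.2 ⟨(Finset.mem_filter.1 hθ).1, (Finset.mem_filter.1 hθ).2.trans_le hxy⟩
  have hcm2 : ∀ x y, x ≤ y → {θ ∈ Ψ | θ ≤ x} ⊆ {θ ∈ Ψ | θ ≤ y} := fun x y hxy θ hθ =>
    Finset.mem_filter.2 ⟨(Finset.mem_filter.1 hθ).1, (Finset.mem_filter.1 hθ).2.trans hxy⟩
  obtain ⟨l, -, hl⟩ := Finset.exists_lt_card_fiber_of_mul_lt_card_of_maps_to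
    (s := Y) (t := Finset.range (2 * (w * m) + 1)) (f := c) (n := s)
    (fun y _ => by
      have h1 := Finset.card_filter_le Θ (fun θ => θ < y)
      have h2 := Finset.card_filter_le Ψ (fun θ => θ ≤ y)
      simp only [Finset.mem_range, hc]
      omega) (by simpa using hs)
  refine ⟨{y ∈ Y | c y = l}, Finset.filter_subset _ _, hl, ?_, ?_⟩
  · intro z hz x hx hxz y hy
    obtain ⟨hxY, hxl⟩ := Finset.mem_filter.1 hx
    obtain ⟨hyY, hyl⟩ := Finset.mem_filter.1 hy
    by_contra hyz
    obtain ⟨θ, hθ, hmax⟩ := exists_greatest_of_isChain (Y := {y ∈ Y | y < z})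
      (hY.mono (Finset.coe_subset.2 (Finset.filter_subset _ _)))
      ⟨x, Finset.mem_filter.2 ⟨hxY, hxz⟩⟩
    obtain ⟨hθY, hθz⟩ := Finset.mem_filter.1 hθ
    have hxθ := hmax x (Finset.mem_filter.2 ⟨hxY, hxz⟩)
    have hθy : θ < y := by
      rcases hY.total hyY hθY with h | h
      · exact absurd (h.trans_lt hθz) hyz
      · exact lt_of_le_of_ne h fun h => hyz (h ▸ hθz)
    have hθΘ : θ ∈ Θ := Finset.mem_filter.2
      ⟨hθY, z, hz, hθz, fun y hy hyz => hmax y (Finset.mem_filter.2 ⟨hy, hyz⟩)⟩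
    have h1 : {θ ∈ Θ | θ < x}.card < {θ ∈ Θ | θ < y}.card :=
      Finset.card_lt_card ⟨hcm1 x y (hxθ.trans hθy.le), fun h =>
        absurd (Finset.mem_filter.1 (h (Finset.mem_filter.2 ⟨hθΘ, hθy⟩))).2 hxθ.not_gt⟩
    have h2 := Finset.card_le_card (hcm2 x y (hxθ.trans hθy.le))
    simp only [hc] at hxl hyl
    omega
  · intro z hz x hx hxz y hy
    obtain ⟨hxY, hxl⟩ := Finset.mem_filter.1 hx
    obtain ⟨hyY, hyl⟩ := Finset.mem_filter.1 hy
    by_contra hyz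
    obtain ⟨θ, hθ, hmin⟩ := exists_least_of_isChain (Y := {y ∈ Y | z < y})
      (hY.mono (Finset.coe_subset.2 (Finset.filter_subset _ _)))
      ⟨x, Finset.mem_filter.2 ⟨hxY, hxz⟩⟩
    obtain ⟨hθY, hθz⟩ := Finset.mem_filter.1 hθ
    have hxθ := hmin x (Finset.mem_filter.2 ⟨hxY, hxz⟩)
    have hθy : y < θ := by
      rcases hY.total hyY hθY with h | h
      · exact lt_of_le_of_ne h fun h => hyz (h ▸ hθz)
      · exact absurd (hθz.trans_le h) hyz
    have hθΨ : θ ∈ Ψ := Finset.mem_filter.2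
      ⟨hθY, z, hz, hθz, fun y hy hyz => hmin y (Finset.mem_filter.2 ⟨hy, hyz⟩)⟩
    have h1 : {θ ∈ Ψ | θ ≤ y}.card < {θ ∈ Ψ | θ ≤ x}.card :=
      Finset.card_lt_card ⟨hcm2 y x (hθy.le.trans hxθ), fun h =>
        absurd (Finset.mem_filter.1 (h (Finset.mem_filter.2 ⟨hθΨ, hxθ⟩))).2 hθy.not_ge⟩
    have h2 := Finset.card_le_card (hcm1 y x (hθy.le.trans hxθ))
    simp only [hc] at hxl hyl
    omega

lemma exists_top_subset (S : Finset ℕ) (n : ℕ) (hn : n ≤ S.card) :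
    ∃ J ⊆ S, J.card = n ∧ ∀ i ∈ S \ J, ∀ j ∈ J, i < j := by
  induction n with
  | zero => exact ⟨∅, Finset.empty_subset _, rfl, by simp⟩
  | succ n ih =>
    obtain ⟨J, hJS, hJ, hJt⟩ := ih (by omega)
    have hne : (S \ J).Nonempty := by
      rw [← Finset.card_pos, Finset.card_sdiff_of_subset hJS]
      omega
    obtain ⟨s, hs, hmax⟩ := (S \ J).exists_max_image id hne
    obtain ⟨hsS, hsJ⟩ := Finset.mem_sdiff.1 hs
    refine ⟨insert s J, Finset.insert_subset hsS hJS, by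
      rw [Finset.card_insert_of_notMem hsJ, hJ], fun i hi j hj => ?_⟩
    obtain ⟨hiS, hiJ⟩ := Finset.mem_sdiff.1 hi
    rw [Finset.mem_insert, not_or] at hiJ
    have hi' := Finset.mem_sdiff.2 ⟨hiS, hiJ.2⟩
    rcases Finset.mem_insert.1 hj with rfl | hj
    · exact lt_of_le_of_ne (hmax i hi') hiJ.1
    · exact hJt i hi' j hj

/-- If a chain `U` lies below `u` and is incomparable to the antichain `A`, then few colours have
an element that is incomparable to `u` and lies below some element of `A`. -/
lemma card_crossing_le {w β : ℕ} {cov : X → Fin w}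
    (hcov : ∀ x y, cov x = cov y → x ≤ y ∨ y ≤ x) {g : X → ℕ} {H : Set X}
    (hpair : ∀ U Z : Finset X, IsChain (· ≤ ·) (U : Set X) → IsChain (· ≤ ·) (Z : Set X) →
      (U : Set X) ⊆ H → (Z : Set X) ⊆ H → β < (U.image g).card → β < (Z.image g).card →
      (∀ u ∈ U, ∀ z ∈ Z, Incomp u z) → False)
    {A B U : Finset X} (hB : IsChain (· ≤ ·) (B : Set X)) (hBH : (B : Set X) ⊆ H)
    (hA : IsAntichain (· ≤ ·) (A : Set X)) {u₀ : X} (hu₀A : u₀ ∈ A) (hu₀B : u₀ ∈ B)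
    (hu₀ : β < ({b ∈ B | b ≤ u₀}.image g).card)
    (hU : IsChain (· ≤ ·) (U : Set X)) (hUH : (U : Set X) ⊆ H) (hUβ : β < (U.image g).card)
    (hUA : ∀ x ∈ U, ∀ a ∈ A, Incomp x a) {u : X} (hu : ∀ x ∈ U, x ≤ u) {D : Finset ℕ}
    (hD : ∀ i ∈ D, ∃ z, g z = i ∧ Incomp z u ∧ (∃ a ∈ A, z < a) ∧
      (z ∈ H ∨ (∀ b ∈ B, b < z) ∨ ∀ b ∈ B, z < b)) :
    D.card ≤ w * β := by
  by_contra! hcon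
  have hz : ∀ i, ∃ z, i ∈ D → g z = i ∧ Incomp z u ∧ (∃ a ∈ A, z < a) ∧
      (z ∈ H ∨ (∀ b ∈ B, b < z) ∨ ∀ b ∈ B, z < b) := by
    intro i
    by_cases h : i ∈ D
    · obtain ⟨z, hz⟩ := hD i h
      exact ⟨z, fun _ => hz⟩
    · exact ⟨u, fun h' => absurd h' h⟩
  choose z hz using hz
  by_cases hall : ∀ i ∈ D, z i ∈ H
  · obtain ⟨l, -, hl⟩ := Finset.exists_lt_card_fiber_of_mul_lt_card_of_maps_to
      (s := D) (t := (Finset.univ : Finset (Fin w))) (f := fun i => cov (z i)) (n := β)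
      (fun _ _ => Finset.mem_univ _) (by simpa using hcon)
    set F := {i ∈ D | cov (z i) = l} with hF
    have hgz : (F.image z).image g = F := by
      rw [Finset.image_image]
      refine (Finset.image_congr fun i hi => ?_).trans Finset.image_id
      exact (hz i (Finset.mem_filter.1 hi).1).1
    refine hpair U (F.image z) hU ?_ hUH ?_ hUβ (by rw [hgz]; exact hl) ?_
    · intro x hx y hy _
      obtain ⟨i, hi, rfl⟩ := Finset.mem_image.1 (Finset.mem_coe.1 hx)
      obtain ⟨j, hj, rfl⟩ := Finset.mem_image.1 (Finset.mem_coe.1 hy)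
      exact hcov _ _ ((Finset.mem_filter.1 hi).2.trans (Finset.mem_filter.1 hj).2.symm)
    · intro x hx
      obtain ⟨i, hi, rfl⟩ := Finset.mem_image.1 (Finset.mem_coe.1 hx)
      exact hall i (Finset.mem_filter.1 hi).1
    · intro x hx y hy
      obtain ⟨i, hi, rfl⟩ := Finset.mem_image.1 hy
      obtain ⟨-, h1, ⟨a, ha, hza⟩, -⟩ := hz i (Finset.mem_filter.1 hi).1
      exact ⟨fun h => (hUA x hx a ha).1 (h.trans hza.le), fun h => h1.1 (h.trans (hu x hx))⟩
  · push Not at hall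
    obtain ⟨i, hi, hiH⟩ := hall
    obtain ⟨-, h1, ⟨a, ha, hza⟩, h2⟩ := hz i hi
    rcases h2 with h2 | h2 | h2
    · exact hiH h2
    · have h3 : u₀ < a := (h2 u₀ hu₀B).trans hza
      exact hA hu₀A ha h3.ne h3.le
    · refine hpair U {b ∈ B | b ≤ u₀} hU
        (hB.mono (Finset.coe_subset.2 (Finset.filter_subset _ _))) hUH
        ((Finset.coe_subset.2 (Finset.filter_subset _ _)).trans hBH) hUβ hu₀ ?_
      intro x hx b hb
      obtain ⟨hbB, hb⟩ := Finset.mem_filter.1 hb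
      exact ⟨fun h => (hUA x hx u₀ hu₀A).1 (h.trans hb),
        fun h => h1.1 (((h2 b hbB).le.trans h).trans (hu x hx))⟩

lemma card_crossing_ge {w β : ℕ} {cov : X → Fin w}
    (hcov : ∀ x y, cov x = cov y → x ≤ y ∨ y ≤ x) {g : X → ℕ} {H : Set X}
    (hpair : ∀ U Z : Finset X, IsChain (· ≤ ·) (U : Set X) → IsChain (· ≤ ·) (Z : Set X) →
      (U : Set X) ⊆ H → (Z : Set X) ⊆ H → β < (U.image g).card → β < (Z.image g).card →
      (∀ u ∈ U, ∀ z ∈ Z, Incomp u z) → False)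
    {A B U : Finset X} (hB : IsChain (· ≤ ·) (B : Set X)) (hBH : (B : Set X) ⊆ H)
    (hA : IsAntichain (· ≤ ·) (A : Set X)) {u₀ : X} (hu₀A : u₀ ∈ A) (hu₀B : u₀ ∈ B)
    (hu₀ : β < ({b ∈ B | u₀ ≤ b}.image g).card)
    (hU : IsChain (· ≤ ·) (U : Set X)) (hUH : (U : Set X) ⊆ H) (hUβ : β < (U.image g).card)
    (hUA : ∀ x ∈ U, ∀ a ∈ A, Incomp x a) {u : X} (hu : ∀ x ∈ U, u ≤ x) {D : Finset ℕ}
    (hD : ∀ i ∈ D, ∃ z, g z = i ∧ Incomp z u ∧ (∃ a ∈ A, a < z) ∧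
      (z ∈ H ∨ (∀ b ∈ B, b < z) ∨ ∀ b ∈ B, z < b)) :
    D.card ≤ w * β := by
  refine card_crossing_le (X := Xᵒᵈ) (cov := cov) (fun x y h => (hcov x y h).symm) (g := g)
    (H := H) (fun U Z hU hZ h1 h2 h3 h4 h5 => hpair U Z hU.symm hZ.symm h1 h2 h3 h4
      fun u hu z hz => (h5 u hu z hz).symm) (A := A) (B := B) (U := U) hB.symm hBH
    (fun a ha b hb hab => hA hb ha hab.symm) hu₀A hu₀B hu₀ hU.symm hUH hUβ
    (fun x hx a ha => (hUA x hx a ha).symm) hu (fun i hi => ?_)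
  obtain ⟨z, h1, h2, h3, h4⟩ := hD i hi
  exact ⟨z, h1, h2.symm, h3, h4.imp_right Or.symm⟩

/-- One step of the nesting argument: an antichain `A` to which many colours have incomparable
elements is extended by an element `u` so that most of these colours have elements incomparable
to `u` as well. -/
lemma exists_nested_element {w β : ℕ} {cov : X → Fin w}
    (hcov : ∀ x y, cov x = cov y → x ≤ y ∨ y ≤ x) {g : X → ℕ}
    (hg : ∀ x y, g x = g y → x ≤ y ∨ y ≤ x)
    (hgr : ∀ x, ∀ i < g x, ∃ y, g y = i ∧ Incomp y x) {H : Set X}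
    (hpair : ∀ U Z : Finset X, IsChain (· ≤ ·) (U : Set X) → IsChain (· ≤ ·) (Z : Set X) →
      (U : Set X) ⊆ H → (Z : Set X) ⊆ H → β < (U.image g).card → β < (Z.image g).card →
      (∀ u ∈ U, ∀ z ∈ Z, Incomp u z) → False)
    {A B : Finset X} (hB : IsChain (· ≤ ·) (B : Set X)) (hBH : (B : Set X) ⊆ H)
    (hBz : ∀ z, g z ∈ B.image g → z ∈ H ∨ (∀ b ∈ B, b < z) ∨ ∀ b ∈ B, z < b)
    (hA : IsAntichain (· ≤ ·) (A : Set X)) {u₀ : X} (hu₀A : u₀ ∈ A) (hu₀B : u₀ ∈ B)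
    (hu₀ : β < ({b ∈ B | b ≤ u₀}.image g).card) (hu₀' : β < ({b ∈ B | u₀ ≤ b}.image g).card)
    {S : Finset ℕ} (hSB : S ⊆ B.image g) (hSc : 2 * (w * β) + 1 ≤ S.card)
    (hS : ∀ i ∈ S, ∃ y, g y = i ∧ ∀ a ∈ A, Incomp y a) :
    ∃ u, (∀ a ∈ A, Incomp u a) ∧ ∃ S' ⊆ S, S.card ≤ S'.card + (4 * (w * β) + 1) ∧
      ∀ i ∈ S', ∃ y, g y = i ∧ Incomp y u ∧ ∀ a ∈ A, Incomp y a := by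
  obtain ⟨J, hJS, hJc, hJt⟩ := exists_top_subset S _ hSc
  have hy : ∀ i, ∃ y, i ∈ S → g y = i ∧ ∀ a ∈ A, Incomp y a := by
    intro i
    by_cases h : i ∈ S
    · obtain ⟨y, hy⟩ := hS i h
      exact ⟨y, fun _ => hy⟩
    · exact ⟨u₀, fun h' => absurd h' h⟩
  choose y hy using hy
  have hyH : ∀ i ∈ S, y i ∈ H := by
    intro i hi
    obtain ⟨h1, h2⟩ := hy i hi
    rcases hBz (y i) (h1.symm ▸ hSB hi) with h | h | h
    · exact h
    · exact absurd (h u₀ hu₀B).le (h2 u₀ hu₀A).2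
    · exact absurd (h u₀ hu₀B).le (h2 u₀ hu₀A).1
  obtain ⟨l, -, hl⟩ := Finset.exists_lt_card_fiber_of_mul_lt_card_of_maps_to
    (s := J) (t := (Finset.univ : Finset (Fin w))) (f := fun i => cov (y i)) (n := 2 * β)
    (fun _ _ => Finset.mem_univ _) (by
      rw [hJc, Finset.card_univ, Fintype.card_fin, Nat.mul_left_comm]; omega)
  set F := {i ∈ J | cov (y i) = l} with hF
  have hFS : F ⊆ S := (Finset.filter_subset _ _).trans hJS
  have hyinj : Set.InjOn y F := fun i hi j hj hij => by
    rw [← (hy i (hFS hi)).1, ← (hy j (hFS hj)).1, hij]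
  have hginj : Set.InjOn g (F.image y : Finset X) := by
    intro a ha b hb hab
    obtain ⟨i, hi, rfl⟩ := Finset.mem_image.1 (Finset.mem_coe.1 ha)
    obtain ⟨j, hj, rfl⟩ := Finset.mem_image.1 (Finset.mem_coe.1 hb)
    rw [(hy i (hFS hi)).1, (hy j (hFS hj)).1] at hab
    rw [hab]
  have hU : IsChain (· ≤ ·) ((F.image y : Finset X) : Set X) := by
    intro a ha b hb _
    obtain ⟨i, hi, rfl⟩ := Finset.mem_image.1 (Finset.mem_coe.1 ha)
    obtain ⟨j, hj, rfl⟩ := Finset.mem_image.1 (Finset.mem_coe.1 hb)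
    exact hcov _ _ ((Finset.mem_filter.1 hi).2.trans (Finset.mem_filter.1 hj).2.symm)
  have hUc : 2 * β < (F.image y).card := by rw [Finset.card_image_of_injOn hyinj]; exact hl
  -- a middle element of the chain has more than `β` colours on either side
  have hmid := card_middle hU β
  obtain ⟨u, hu⟩ := Finset.card_pos.1 (show 0 < {b ∈ F.image y |
    β < {a ∈ F.image y | a ≤ b}.card ∧ β < {a ∈ F.image y | b ≤ a}.card}.card by omega)
  obtain ⟨huU, hu1, hu2⟩ := Finset.mem_filter.1 hu
  have hUS : ∀ x ∈ F.image y, x ∈ H ∧ ∀ a ∈ A, Incomp x a := by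
    intro x hx
    obtain ⟨i, hi, rfl⟩ := Finset.mem_image.1 hx
    exact ⟨hyH i (hFS hi), (hy i (hFS hi)).2⟩
  have himg : ∀ (p : X → Prop), (({a ∈ F.image y | p a}).image g).card =
      ({a ∈ F.image y | p a}).card := fun p => Finset.card_image_of_injOn
    (hginj.mono (Finset.coe_subset.2 (Finset.filter_subset _ _)))
  refine ⟨u, (hUS u huU).2, {i ∈ S \ J | ∃ z, g z = i ∧ Incomp z u ∧ ∀ a ∈ A, Incomp z a},
    (Finset.filter_subset _ _).trans Finset.sdiff_subset, ?_, fun i hi => (Finset.mem_filter.1 hi).2⟩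
  have hlow := card_crossing_le hcov hpair hB hBH hA hu₀A hu₀B hu₀
    (U := {a ∈ F.image y | a ≤ u}) (hU.mono (Finset.coe_subset.2 (Finset.filter_subset _ _)))
    (fun x hx => (hUS x (Finset.mem_filter.1 hx).1).1) (by rw [himg]; exact hu1)
    (fun x hx => (hUS x (Finset.mem_filter.1 hx).1).2) (u := u)
    (fun x hx => (Finset.mem_filter.1 hx).2)
    (D := {i ∈ S | ∃ z, g z = i ∧ Incomp z u ∧ ∃ a ∈ A, z < a}) (fun i hi => by
      obtain ⟨hiS, z, h1, h2, h3⟩ := Finset.mem_filter.1 hi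
      exact ⟨z, h1, h2, h3, hBz z (h1.symm ▸ hSB hiS)⟩)
  have hupp := card_crossing_ge hcov hpair hB hBH hA hu₀A hu₀B hu₀'
    (U := {a ∈ F.image y | u ≤ a}) (hU.mono (Finset.coe_subset.2 (Finset.filter_subset _ _)))
    (fun x hx => (hUS x (Finset.mem_filter.1 hx).1).1) (by rw [himg]; exact hu2)
    (fun x hx => (hUS x (Finset.mem_filter.1 hx).1).2) (u := u)
    (fun x hx => (Finset.mem_filter.1 hx).2)
    (D := {i ∈ S | ∃ z, g z = i ∧ Incomp z u ∧ ∃ a ∈ A, a < z}) (fun i hi => by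
      obtain ⟨hiS, z, h1, h2, h3⟩ := Finset.mem_filter.1 hi
      exact ⟨z, h1, h2, h3, hBz z (h1.symm ▸ hSB hiS)⟩)
  have hcover : S ⊆ {i ∈ S \ J | ∃ z, g z = i ∧ Incomp z u ∧ ∀ a ∈ A, Incomp z a} ∪ (J ∪
      ({i ∈ S | ∃ z, g z = i ∧ Incomp z u ∧ ∃ a ∈ A, z < a} ∪
        {i ∈ S | ∃ z, g z = i ∧ Incomp z u ∧ ∃ a ∈ A, a < z})) := by
    intro i hi
    by_cases hiJ : i ∈ J
    · simp [hiJ]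
    obtain ⟨j, hj, rfl⟩ := Finset.mem_image.1 huU
    have hij : i < g (y j) := by
      rw [(hy j (hFS hj)).1]
      exact hJt i (Finset.mem_sdiff.2 ⟨hi, hiJ⟩) j (Finset.filter_subset _ _ hj)
    obtain ⟨z, hz1, hz2⟩ := hgr _ i hij
    by_cases hall : ∀ a ∈ A, Incomp z a
    · exact Finset.mem_union_left _
        (Finset.mem_filter.2 ⟨Finset.mem_sdiff.2 ⟨hi, hiJ⟩, z, hz1, hz2, hall⟩)
    · push Not at hall
      obtain ⟨a, ha, hza⟩ := hall
      have hne : z ≠ a := by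
        rintro rfl
        rcases hg (y i) z ((hy i hi).1.trans hz1.symm) with h | h
        · exact ((hy i hi).2 z ha).1 h
        · exact ((hy i hi).2 z ha).2 h
      refine Finset.mem_union_right _ (Finset.mem_union_right _ ?_)
      by_cases hle : z ≤ a
      · exact Finset.mem_union_left _
          (Finset.mem_filter.2 ⟨hi, z, hz1, hz2, a, ha, lt_of_le_of_ne hle hne⟩)
      · have hge : a ≤ z := by
          by_contra hge
          exact hza ⟨hle, hge⟩
        exact Finset.mem_union_right _
          (Finset.mem_filter.2 ⟨hi, z, hz1, hz2, a, ha, lt_of_le_of_ne hge hne.symm⟩)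
  have h1 := Finset.card_le_card hcover
  have h2 := Finset.card_union_le {i ∈ S \ J | ∃ z, g z = i ∧ Incomp z u ∧ ∀ a ∈ A, Incomp z a}
    (J ∪ ({i ∈ S | ∃ z, g z = i ∧ Incomp z u ∧ ∃ a ∈ A, z < a} ∪
        {i ∈ S | ∃ z, g z = i ∧ Incomp z u ∧ ∃ a ∈ A, a < z}))
  have h3 := Finset.card_union_le J ({i ∈ S | ∃ z, g z = i ∧ Incomp z u ∧ ∃ a ∈ A, z < a} ∪
        {i ∈ S | ∃ z, g z = i ∧ Incomp z u ∧ ∃ a ∈ A, a < z})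
  have h4 := Finset.card_union_le {i ∈ S | ∃ z, g z = i ∧ Incomp z u ∧ ∃ a ∈ A, z < a}
        {i ∈ S | ∃ z, g z = i ∧ Incomp z u ∧ ∃ a ∈ A, a < z}
  omega

lemma card_antichain_le {w : ℕ} {cov : X → Fin w}
    (hcov : ∀ x y, cov x = cov y → x ≤ y ∨ y ≤ x) {A : Finset X}
    (hA : IsAntichain (· ≤ ·) (A : Set X)) : A.card ≤ w := by
  have h : Set.InjOn cov A := by
    intro a ha b hb hab
    by_contra hne
    rcases hcov a b hab with h | h
    · exact hA ha hb hne h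
    · exact hA hb ha (Ne.symm hne) h
  have := Finset.card_le_card_of_injOn (t := (Finset.univ : Finset (Fin w))) cov
    (fun _ _ => Finset.mem_univ _) h
  simpa using this

/-- A block of a chain that is not separated by elements of its own colours outside `H` has few
elements: otherwise the nesting argument produces an antichain with `w + 1` elements. -/
lemma card_block_le {w β : ℕ} {cov : X → Fin w}
    (hcov : ∀ x y, cov x = cov y → x ≤ y ∨ y ≤ x) {g : X → ℕ}
    (hg : ∀ x y, g x = g y → x ≤ y ∨ y ≤ x)
    (hgr : ∀ x, ∀ i < g x, ∃ y, g y = i ∧ Incomp y x) {H : Set X}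
    (hpair : ∀ U Z : Finset X, IsChain (· ≤ ·) (U : Set X) → IsChain (· ≤ ·) (Z : Set X) →
      (U : Set X) ⊆ H → (Z : Set X) ⊆ H → β < (U.image g).card → β < (Z.image g).card →
      (∀ u ∈ U, ∀ z ∈ Z, Incomp u z) → False)
    {B : Finset X} (hB : IsChain (· ≤ ·) (B : Set X)) (hBH : (B : Set X) ⊆ H)
    (hBg : Set.InjOn g B)
    (hBz : ∀ z, g z ∈ B.image g → z ∈ H ∨ (∀ b ∈ B, b < z) ∨ ∀ b ∈ B, z < b) :
    B.card ≤ 2 * β + w * (4 * (w * β) + 1) := by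
  by_contra! hcon
  have hmid := card_middle hB β
  set M := {b ∈ B | β < {a ∈ B | a ≤ b}.card ∧ β < {a ∈ B | b ≤ a}.card} with hM
  have hMB : M ⊆ B := Finset.filter_subset _ _
  obtain ⟨u₀, hu₀, hmax⟩ := M.exists_max_image g (Finset.card_pos.1 (by omega))
  obtain ⟨hu₀B, hu1, hu2⟩ := Finset.mem_filter.1 hu₀
  have himg : ∀ (p : X → Prop), (({a ∈ B | p a}).image g).card = ({a ∈ B | p a}).card :=
    fun p => Finset.card_image_of_injOn
      (hBg.mono (Finset.coe_subset.2 (Finset.filter_subset _ _)))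
  have hMg : (M.image g).card = M.card :=
    Finset.card_image_of_injOn (hBg.mono (Finset.coe_subset.2 hMB))
  have nest : ∀ t ≤ w, ∃ A : Finset X, IsAntichain (· ≤ ·) (A : Set X) ∧ u₀ ∈ A ∧
      A.card = t + 1 ∧ ∃ S ⊆ B.image g, M.card ≤ S.card + 1 + t * (4 * (w * β) + 1) ∧
        ∀ i ∈ S, ∃ y, g y = i ∧ ∀ a ∈ A, Incomp y a := by
    intro t
    induction t with
    | zero =>
      intro _
      refine ⟨{u₀}, by simp, by simp, by simp, (M.image g).erase (g u₀),
        (Finset.erase_subset _ _).trans (Finset.image_subset_image hMB), ?_, ?_⟩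
      · rw [Finset.card_erase_of_mem (Finset.mem_image_of_mem g hu₀), hMg]
        omega
      · intro i hi
        obtain ⟨hne, hi⟩ := Finset.mem_erase.1 hi
        obtain ⟨b, hb, rfl⟩ := Finset.mem_image.1 hi
        obtain ⟨y, hy1, hy2⟩ := hgr u₀ _ (lt_of_le_of_ne (hmax b hb) hne)
        exact ⟨y, hy1, by simpa using hy2⟩
    | succ t ih =>
      intro htw
      obtain ⟨A, hA, huA, hAc, S, hSB, hSc, hS⟩ := ih (by omega)
      have hle : (t + 1) * (4 * (w * β) + 1) ≤ w * (4 * (w * β) + 1) :=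
        Nat.mul_le_mul_right _ htw
      rw [add_mul, one_mul] at hle
      obtain ⟨u, hu, S', hS'S, hS'c, hS'⟩ := exists_nested_element hcov hg hgr hpair hB hBH hBz
        hA huA hu₀B (by rw [himg]; exact hu1) (by rw [himg]; exact hu2) hSB (by omega) hS
      refine ⟨insert u A, ?_, Finset.mem_insert_of_mem huA, ?_, S', hS'S.trans hSB, ?_, ?_⟩
      · rw [Finset.coe_insert]
        exact hA.insert (fun b hb _ => (hu b hb).2) (fun b hb _ => (hu b hb).1)
      · rw [Finset.card_insert_of_notMem fun h => (hu u h).1 le_rfl, hAc]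
      · rw [add_mul, one_mul]
        omega
      · intro i hi
        obtain ⟨y, h1, h2, h3⟩ := hS' i hi
        refine ⟨y, h1, fun a ha => ?_⟩
        rcases Finset.mem_insert.1 ha with rfl | ha
        · exact h2
        · exact h3 a ha
  obtain ⟨A, hA, -, hAc, -⟩ := nest w le_rfl
  have := card_antichain_le hcov hA
  omega

/-- The number of colours of First-Fit on a chain, in terms of the width of its convex hull.
The induction halves this width: of two incomparable chains in the hull, one has a
convex hull of at most half the width, and hence few colours. -/
lemma card_colors_chain_le {w m : ℕ} {cov : X → Fin w}
    (hcov : ∀ x y, cov x = cov y → x ≤ y ∨ y ≤ x) (hm : 1 ≤ m)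
    (hlad : ∀ T : Finset (X × X), IsLadder T → T.card ≤ m) {g : X → ℕ}
    (hg : ∀ x y, g x = g y → x ≤ y ∨ y ≤ x)
    (hgr : ∀ x, ∀ i < g x, ∃ y, g y = i ∧ Incomp y x) (k : ℕ) :
    ∀ Y : Finset X, IsChain (· ≤ ·) (Y : Set X) →
      (∀ T : Finset X, IsAntichain (· ≤ ·) (T : Set X) → (T : Set X) ⊆ hull Y → T.card < 2 ^ k) →
      (Y.image g).card ≤ (32 * w ^ 3 * m) ^ k := by
  induction k with
  | zero =>
    intro Y hY hT
    rcases Y.eq_empty_or_nonempty with rfl | ⟨y, hy⟩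
    · simp
    · have := hT {y} (by simp) (by
        rw [Finset.coe_singleton, Set.singleton_subset_iff]
        exact ⟨⟨y, hy, le_rfl⟩, y, hy, le_rfl⟩)
      simp at this
  | succ k ih =>
    intro Y₀ hY₀ hT₀
    obtain ⟨Y', hY'Y, hY'⟩ := Set.exists_subset_bijOn (Y₀ : Set X) g
    obtain ⟨Y, rfl⟩ := (Y₀.finite_toSet.subset hY'Y).exists_finset_coe
    have hYY₀ : Y ⊆ Y₀ := Finset.coe_subset.1 hY'Y
    have hcard : (Y₀.image g).card = Y.card := by
      rw [← Finset.card_image_of_injOn hY'.injOn]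
      congr 1
      apply Finset.coe_injective
      rw [Finset.coe_image, Finset.coe_image, hY'.image_eq]
    rw [hcard]
    have hY := hY₀.mono hY'Y
    rcases Y.eq_empty_or_nonempty with rfl | hne
    · simp
    obtain ⟨t, htY, ht⟩ := exists_greatest_of_isChain hY hne
    obtain ⟨b, hbY, hb⟩ := exists_least_of_isChain hY hne
    have hw : 1 ≤ w := (Nat.succ_le_of_lt (cov t).pos)
    have hull_sub : ∀ U : Finset X, (U : Set X) ⊆ hull Y → hull U ⊆ hull Y := by
      rintro U hU z ⟨⟨a, ha, haz⟩, c, hc, hzc⟩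
      obtain ⟨⟨a', ha', haa'⟩, -⟩ := hU ha
      obtain ⟨-, c', hc', hcc'⟩ := hU hc
      exact ⟨⟨a', ha', haa'.trans haz⟩, c', hc', hzc.trans hcc'⟩
    set β := (32 * w ^ 3 * m) ^ k with hβ
    have hβ1 : 1 ≤ β := Nat.one_le_pow _ _ (by positivity)
    have hpair : ∀ U Z : Finset X, IsChain (· ≤ ·) (U : Set X) → IsChain (· ≤ ·) (Z : Set X) →
        (U : Set X) ⊆ hull Y → (Z : Set X) ⊆ hull Y → β < (U.image g).card →
        β < (Z.image g).card → (∀ u ∈ U, ∀ z ∈ Z, Incomp u z) → False := by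
      intro U Z hU hZ hUY hZY hUβ hZβ hUZ
      have big : ∀ W : Finset X, IsChain (· ≤ ·) (W : Set X) → β < (W.image g).card →
          ∃ T : Finset X, IsAntichain (· ≤ ·) (T : Set X) ∧ (T : Set X) ⊆ hull W ∧
            2 ^ k ≤ T.card := by
        intro W hW hWβ
        by_contra! hno
        exact absurd (ih W hW fun T h1 h2 => hno T h1 h2) (not_le_of_gt hWβ)
      obtain ⟨T₁, h1, h2, h3⟩ := big U hU hUβ
      obtain ⟨T₂, h4, h5, h6⟩ := big Z hZ hZβ
      have hinc : ∀ x ∈ T₁, ∀ y ∈ T₂, Incomp x y := by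
        intro x hx y hy
        obtain ⟨⟨a, ha, hax⟩, c, hc, hxc⟩ := h2 hx
        obtain ⟨⟨a', ha', hay⟩, c', hc', hyc⟩ := h5 hy
        exact ⟨fun h => (hUZ a ha c' hc').1 ((hax.trans h).trans hyc),
          fun h => (hUZ c hc a' ha').2 ((hay.trans h).trans hxc)⟩
      have hdisj : Disjoint T₁ T₂ := Finset.disjoint_left.2 fun x hx hx' =>
        (hinc x hx x hx').1 le_rfl
      have hanti : IsAntichain (· ≤ ·) ((T₁ ∪ T₂ : Finset X) : Set X) := by
        rw [Finset.coe_union, isAntichain_union]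
        exact ⟨h1, h4, fun x hx y hy _ => ⟨(hinc x hx y hy).1, (hinc x hx y hy).2⟩⟩
      have hlt := hT₀ (T₁ ∪ T₂) hanti (by
        rw [Finset.coe_union]
        refine (Set.union_subset (h2.trans (hull_sub U hUY)) (h5.trans (hull_sub Z hZY))).trans ?_
        rintro z ⟨⟨a, ha, haz⟩, c, hc, hzc⟩
        exact ⟨⟨a, hYY₀ ha, haz⟩, c, hYY₀ hc, hzc⟩)
      rw [Finset.card_union_of_disjoint hdisj, pow_succ] at hlt
      omega
    by_contra! hcon
    have hnum : (2 * (w * m) + 1) * (2 * β + w * (4 * (w * β) + 1)) <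
        Y.card := by
      refine lt_of_le_of_lt ?_ hcon
      rw [pow_succ, ← hβ]
      have h1 : 2 * (w * m) + 1 ≤ 3 * (w * m) := by nlinarith
      have h2 : 2 * β + w * (4 * (w * β) + 1) ≤ 7 * (w ^ 2 * β) := by
        have : β ≤ w ^ 2 * β := Nat.le_mul_of_pos_left _ (by positivity)
        have : w ≤ w ^ 2 * β := by nlinarith [Nat.mul_le_mul hw hβ1]
        nlinarith
      calc _ ≤ 3 * (w * m) * (7 * (w ^ 2 * β)) := Nat.mul_le_mul h1 h2
        _ = 21 * (w ^ 3 * m * β) := by ring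
        _ ≤ 32 * (w ^ 3 * m * β) := Nat.mul_le_mul_right _ (by norm_num)
        _ = _ := by ring
    obtain ⟨B, hBY, hBc, hBt, hBb⟩ := exists_block hcov hlad hY ht hb hnum
    refine absurd (card_block_le hcov hg hgr hpair (hY.mono (Finset.coe_subset.2 hBY))
      (fun x hx => ⟨⟨x, hBY hx, le_rfl⟩, x, hBY hx, le_rfl⟩)
      (hY'.injOn.mono (Finset.coe_subset.2 hBY)) ?_) (not_le_of_gt hBc)
    intro z hz
    obtain ⟨x, hx, hxz⟩ := Finset.mem_image.1 hz
    rcases hg x z hxz with h | h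
    · rcases h.eq_or_lt with rfl | h
      · exact Or.inl ⟨⟨x, hBY hx, le_rfl⟩, x, hBY hx, le_rfl⟩
      by_cases hzt : z ≤ t
      · exact Or.inl ⟨⟨x, hBY hx, h.le⟩, t, htY, hzt⟩
      refine Or.inr (Or.inl fun y hy => ?_)
      by_cases htz : t ≤ z
      · exact lt_of_le_of_ne ((ht y (hBY hy)).trans htz) fun h => hzt (h ▸ ht y (hBY hy))
      · exact hBt z ⟨hzt, htz⟩ x hx h y hy
    · rcases h.eq_or_lt with rfl | h
      · exact Or.inl ⟨⟨z, hBY hx, le_rfl⟩, z, hBY hx, le_rfl⟩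
      by_cases hzb : b ≤ z
      · exact Or.inl ⟨⟨b, hbY, hzb⟩, x, hBY hx, h.le⟩
      refine Or.inr (Or.inr fun y hy => ?_)
      by_cases hbz : z ≤ b
      · exact lt_of_le_of_ne (hbz.trans (hb y (hBY hy))) fun h => hzb (h ▸ hb y (hBY hy))
      · exact hBb z ⟨hbz, hzb⟩ x hx h y hy

/-- First-Fit uses few colours on a poset of width at most `w` all of whose ladders are short. -/
theorem firstFit_color_le {w m : ℕ} {cov : X → Fin w}
    (hcov : ∀ x y, cov x = cov y → x ≤ y ∨ y ≤ x) (hm : 1 ≤ m)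
    (hlad : ∀ T : Finset (X × X), IsLadder T → T.card ≤ m) {g : X → ℕ}
    (hg : ∀ x y, g x = g y → x ≤ y ∨ y ≤ x)
    (hgr : ∀ x, ∀ i < g x, ∃ y, g y = i ∧ Incomp y x) {k : ℕ} (hk : w < 2 ^ k) (x : X) :
    g x ≤ (w - 1) * (32 * w ^ 3 * m) ^ k := by
  by_contra! hcon
  have hy : ∀ i, ∃ y, i < g x → g y = i ∧ Incomp y x := by
    intro i
    by_cases h : i < g x
    · obtain ⟨y, hy⟩ := hgr x i h
      exact ⟨y, fun _ => hy⟩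
    · exact ⟨x, fun h' => absurd h' h⟩
  choose y hy using hy
  obtain ⟨l, -, hl⟩ := Finset.exists_lt_card_fiber_of_mul_lt_card_of_maps_to
    (s := Finset.range (g x)) (t := (Finset.univ : Finset (Fin w)).erase (cov x))
    (f := fun i => cov (y i)) (n := (32 * w ^ 3 * m) ^ k) (fun i hi => by
      obtain ⟨-, h⟩ := hy i (Finset.mem_range.1 hi)
      refine Finset.mem_erase.2 ⟨fun he => ?_, Finset.mem_univ _⟩
      rcases hcov _ _ he with h' | h'
      · exact h.1 h'
      · exact h.2 h') (by
      rw [Finset.card_erase_of_mem (Finset.mem_univ _)]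
      simpa using hcon)
  set F := {i ∈ Finset.range (g x) | cov (y i) = l} with hF
  have hgF : (F.image y).image g = F := by
    rw [Finset.image_image]
    refine (Finset.image_congr fun i hi => ?_).trans Finset.image_id
    exact (hy i (Finset.mem_range.1 (Finset.mem_filter.1 hi).1)).1
  have := card_colors_chain_le hcov hm hlad hg hgr k (F.image y) (by
    intro a ha b hb _
    obtain ⟨i, hi, rfl⟩ := Finset.mem_image.1 (Finset.mem_coe.1 ha)
    obtain ⟨j, hj, rfl⟩ := Finset.mem_image.1 (Finset.mem_coe.1 hb)
    exact hcov _ _ ((Finset.mem_filter.1 hi).2.trans (Finset.mem_filter.1 hj).2.symm))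
    (fun T hT _ => (card_antichain_le hcov hT).trans_lt hk)
  rw [hgF] at this
  omega

end FirstFit

/-! ### Linearly ordered systems of levels -/

section Levels

open scoped Classical

variable {α : Type*}

/-- Among the levels older than `v`, the level `p` is the last one before `v`. -/
def IsPred (lt : ℕ → ℕ → Prop) (p v : ℕ) : Prop :=
  p < v ∧ lt p v ∧ ∀ w < v, lt w v → w = p ∨ lt w p

/-- Among the levels older than `u`, the level `s` is the first one after `u`. -/
def IsSucc (lt : ℕ → ℕ → Prop) (s u : ℕ) : Prop :=
  s < u ∧ lt u s ∧ ∀ w < u, lt u w → w = s ∨ lt s w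

/-- The order relation between the elements of two levels. Levels are named by the time of
their insertion, `lt` is their linear order and `c u v` is a relation between
the elements of `u` and `v`. The relation of two levels is obtained from the one between the older
level and the neighbour, at the time of its insertion, of the younger level;
hence it does not depend on levels inserted later. -/
inductive Link (lt : ℕ → ℕ → Prop) (c : ℕ → ℕ → α → α → Prop) : ℕ → ℕ → α → α → Prop
  | predBase {p v : ℕ} {a b : α} : IsPred lt p v → c p v a b → Link lt c p v a b
  | succBase {s u : ℕ} {a b : α} : IsSucc lt s u → c u s a b → Link lt c u s a b
  | pred {u p v : ℕ} {a m b : α} : IsPred lt p v → u < v → lt u p → Link lt c u p a m →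
      c p v m b → Link lt c u v a b
  | succ {u s v : ℕ} {a m b : α} : IsSucc lt s u → v < u → lt s v → c u s a m →
      Link lt c s v m b → Link lt c u v a b

/-- A linearly ordered system of levels, each with `k` elements, with relations `c u v` that are
closed under composition and consist of edges that lie in perfect matchings. -/
structure IsLevelSystem (L : Set ℕ) (lt : ℕ → ℕ → Prop) (c : ℕ → ℕ → α → α → Prop)
    (A : ℕ → Finset α) (k : ℕ) : Prop where
  mem_left : ∀ {u v}, lt u v → u ∈ L
  mem_right : ∀ {u v}, lt u v → v ∈ L
  irrefl : ∀ u, ¬ lt u u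
  trans : ∀ {u v t}, lt u v → lt v t → lt u t
  total : ∀ {u v}, u ∈ L → v ∈ L → u ≠ v → lt u v ∨ lt v u
  card : ∀ {u}, u ∈ L → (A u).card = k
  mem_c : ∀ {u v a b}, c u v a b → a ∈ A u ∧ b ∈ A v
  comp : ∀ {u v t a b d}, lt u v → lt v t → c u v a b → c v t b d → c u t a d
  matching : ∀ {u v a b}, lt u v → c u v a b →
    ∃ φ : α → α, φ a = b ∧ Set.InjOn φ (A u) ∧ ∀ x ∈ A u, c u v x (φ x)
  exists_matching : ∀ {u v}, lt u v → ∃ φ : α → α, Set.InjOn φ (A u) ∧ ∀ x ∈ A u, c u v x (φ x)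

variable {L : Set ℕ} {lt : ℕ → ℕ → Prop} {c : ℕ → ℕ → α → α → Prop} {A : ℕ → Finset α} {k : ℕ}

lemma Link.flip {u v : ℕ} {a b : α} (h : Link lt c u v a b) :
    Link (fun x y => lt y x) (fun x y a b => c y x b a) v u b a := by
  induction h with
  | predBase h1 h2 => exact .succBase h1 h2
  | succBase h1 h2 => exact .predBase h1 h2
  | pred h1 h2 h3 _ h5 ih => exact .succ h1 h2 h3 h5 ih
  | succ h1 h2 h3 h4 _ ih => exact .pred h1 h2 h3 ih h4

namespace IsLevelSystem

lemma exists_inverse_matching {S T : Finset α} (hST : S.card = T.card) {φ : α → α}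
    (hφ : Set.InjOn φ S) (hm : ∀ x ∈ S, φ x ∈ T) :
    ∃ ψ : α → α, (∀ x ∈ S, ψ (φ x) = x) ∧ Set.InjOn ψ T ∧ ∀ y ∈ T, ψ y ∈ S ∧ φ (ψ y) = y := by
  have himg : S.image φ = T := by
    refine Finset.eq_of_subset_of_card_le (Finset.image_subset_iff.2 hm) ?_
    rw [Finset.card_image_of_injOn hφ, hST]
  have hsurj : ∀ y ∈ T, ∃ x ∈ (S : Set α), φ x = y := by
    intro y hy
    rw [← himg] at hy
    simpa using hy
  rcases S.eq_empty_or_nonempty with rfl | ⟨s, hs⟩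
  · have : T = ∅ := by rw [← himg]; simp
    subst this
    exact ⟨id, by simp, by simp, by simp⟩
  have : Nonempty α := ⟨s⟩
  refine ⟨Function.invFunOn φ S, fun x hx => hφ.leftInvOn_invFunOn hx, ?_, fun y hy =>
    ⟨Function.invFunOn_mem (hsurj y hy), Function.invFunOn_eq (hsurj y hy)⟩⟩
  intro y hy z hz hyz
  rw [← Function.invFunOn_eq (hsurj y hy), ← Function.invFunOn_eq (hsurj z hz), hyz]

/-- Reversing the order of the levels. -/
lemma dual (h : IsLevelSystem L lt c A k) :
    IsLevelSystem L (fun x y => lt y x) (fun x y a b => c y x b a) A k where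
  mem_left := h.mem_right
  mem_right := h.mem_left
  irrefl := h.irrefl
  trans := fun h1 h2 => h.trans h2 h1
  total := fun h1 h2 h3 => h.total h2 h1 h3.symm
  card := h.card
  mem_c := fun h1 => (h.mem_c h1).symm
  comp := fun h1 h2 h3 h4 => h.comp h2 h1 h4 h3
  matching := by
    intro u v a b huv hc
    obtain ⟨φ, h1, h2, h3⟩ := h.matching huv hc
    obtain ⟨ψ, h4, h5, h6⟩ := exists_inverse_matching (T := A u)
      ((h.card (h.mem_left huv)).trans (h.card (h.mem_right huv)).symm) h2
      fun x hx => (h.mem_c (h3 x hx)).2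
    refine ⟨ψ, by rw [← h1]; exact h4 _ (h.mem_c hc).1, h5, fun y hy => ?_⟩
    have := h3 _ (h6 y hy).1
    rwa [(h6 y hy).2] at this
  exists_matching := by
    intro u v huv
    obtain ⟨φ, h2, h3⟩ := h.exists_matching huv
    obtain ⟨ψ, h4, h5, h6⟩ := exists_inverse_matching (T := A u)
      ((h.card (h.mem_left huv)).trans (h.card (h.mem_right huv)).symm) h2
      fun x hx => (h.mem_c (h3 x hx)).2
    refine ⟨ψ, h5, fun y hy => ?_⟩
    have := h3 _ (h6 y hy).1
    rwa [(h6 y hy).2] at this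

variable (h : IsLevelSystem L lt c A k)
include h

lemma asymm {u v : ℕ} (huv : lt u v) : ¬ lt v u := fun hvu => h.irrefl _ (h.trans huv hvu)

lemma ne {u v : ℕ} (huv : lt u v) : u ≠ v := fun he => h.irrefl v (he ▸ huv)

lemma exists_last (S : Finset ℕ) (hS : ∀ u ∈ S, u ∈ L) (hne : S.Nonempty) :
    ∃ p ∈ S, ∀ w ∈ S, w = p ∨ lt w p := by
  induction S using Finset.induction_on with
  | empty => simp at hne
  | insert x S hx ih =>
    rcases S.eq_empty_or_nonempty with rfl | hne'
    · exact ⟨x, by simp, by simp⟩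
    obtain ⟨p, hp, hmax⟩ := ih (fun u hu => hS u (Finset.mem_insert_of_mem hu)) hne'
    rcases h.total (hS x (Finset.mem_insert_self _ _)) (hS p (Finset.mem_insert_of_mem hp))
      (fun he => hx (he ▸ hp)) with hlt | hlt
    · refine ⟨p, Finset.mem_insert_of_mem hp, fun w hw => ?_⟩
      rcases Finset.mem_insert.1 hw with rfl | hw
      · exact Or.inr hlt
      · exact hmax w hw
    · refine ⟨x, Finset.mem_insert_self _ _, fun w hw => ?_⟩
      rcases Finset.mem_insert.1 hw with rfl | hw
      · exact Or.inl rfl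
      · rcases hmax w hw with rfl | hw
        · exact Or.inr hlt
        · exact Or.inr (h.trans hw hlt)

lemma exists_isPred {u v : ℕ} (huv : lt u v) (hlt : u < v) :
    ∃ p, IsPred lt p v ∧ (u = p ∨ lt u p) := by
  obtain ⟨p, hp, hmax⟩ := h.exists_last {w ∈ Finset.range v | lt w v}
    (fun w hw => h.mem_left (Finset.mem_filter.1 hw).2)
    ⟨u, Finset.mem_filter.2 ⟨Finset.mem_range.2 hlt, huv⟩⟩
  obtain ⟨hp1, hp2⟩ := Finset.mem_filter.1 hp
  exact ⟨p, ⟨Finset.mem_range.1 hp1, hp2, fun w hw hwv =>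
    hmax w (Finset.mem_filter.2 ⟨Finset.mem_range.2 hw, hwv⟩)⟩,
    hmax u (Finset.mem_filter.2 ⟨Finset.mem_range.2 hlt, huv⟩)⟩

lemma lt_of_link {u v : ℕ} {a b : α} (hl : Link lt c u v a b) : lt u v := by
  induction hl with
  | predBase h1 _ => exact h1.2.1
  | succBase h1 _ => exact h1.2.1
  | pred h1 _ h3 _ _ _ => exact h.trans h3 h1.2.1
  | succ h1 _ h3 _ _ _ => exact h.trans h1.2.1 h3

lemma mem_of_link {u v : ℕ} {a b : α} (hl : Link lt c u v a b) : a ∈ A u ∧ b ∈ A v := by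
  induction hl with
  | predBase _ h2 => exact h.mem_c h2
  | succBase _ h2 => exact h.mem_c h2
  | pred _ _ _ _ h5 ih => exact ⟨ih.1, (h.mem_c h5).2⟩
  | succ _ _ _ h4 _ ih => exact ⟨(h.mem_c h4).1, ih.2⟩

omit h in
lemma link_pred_inv {u v : ℕ} {a b : α} (hl : Link lt c u v a b) (hlt : u < v) :
    ∃ p m, IsPred lt p v ∧ c p v m b ∧ ((u = p ∧ a = m) ∨ (lt u p ∧ Link lt c u p a m)) := by
  cases hl with
  | predBase h1 h2 => exact ⟨u, a, h1, h2, Or.inl ⟨rfl, rfl⟩⟩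
  | succBase h1 _ => exact absurd h1.1 hlt.not_gt
  | pred h1 _ h3 h4 h5 => exact ⟨_, _, h1, h5, Or.inr ⟨h3, h4⟩⟩
  | succ _ h2 _ _ _ => exact absurd h2 hlt.not_gt

omit h in
lemma link_succ_inv {u v : ℕ} {a b : α} (hl : Link lt c u v a b) (hlt : v < u) :
    ∃ s m, IsSucc lt s u ∧ c u s a m ∧ ((s = v ∧ m = b) ∨ (lt s v ∧ Link lt c s v m b)) := by
  cases hl with
  | predBase h1 _ => exact absurd h1.1 hlt.not_gt
  | succBase h1 h2 => exact ⟨_, _, h1, h2, Or.inl ⟨rfl, rfl⟩⟩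
  | pred _ h2 _ _ _ => exact absurd h2 hlt.not_gt
  | succ h1 _ h3 h4 h5 => exact ⟨_, _, h1, h4, Or.inr ⟨h3, h5⟩⟩

/-- At the time before the insertion of `v`, its two neighbours are adjacent. -/
lemma link_of_neighbours {p v s : ℕ} {a m b : α} (hp : IsPred lt p v) (hs : IsSucc lt s v)
    (h1 : c p v a m) (h2 : c v s m b) : Link lt c p s a b := by
  have hc := h.comp hp.2.1 hs.2.1 h1 h2
  have hps := h.trans hp.2.1 hs.2.1
  rcases lt_or_gt_of_ne (h.ne hps) with hlt | hlt
  · refine .predBase ⟨hlt, hps, fun w hw hws => ?_⟩ hc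
    rcases h.total (h.mem_left hws) (h.mem_right hp.2.1) (hw.trans hs.1).ne with hwv | hwv
    · exact hp.2.2 w (hw.trans hs.1) hwv
    · rcases hs.2.2 w (hw.trans hs.1) hwv with rfl | hsw
      · exact absurd hws (h.irrefl _)
      · exact absurd hws (h.asymm hsw)
  · refine .succBase ⟨hlt, hps, fun w hw hpw => ?_⟩ hc
    rcases h.total (h.mem_right hpw) (h.mem_right hp.2.1) (hw.trans hp.1).ne with hwv | hwv
    · rcases hp.2.2 w (hw.trans hp.1) hwv with rfl | hwp
      · exact absurd hpw (h.irrefl _)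
      · exact absurd hpw (h.asymm hwp)
    · exact hs.2.2 w (hw.trans hp.1) hwv

/-- The relations between levels are transitive; the proof removes the youngest of the
three levels. -/
lemma link_trans {u v t : ℕ} {a b d : α} (h1 : Link lt c u v a b) (h2 : Link lt c v t b d) :
    Link lt c u t a d := by
  have main : ∀ N u v t (a b d : α), u < N → v < N → t < N → Link lt c u v a b →
      Link lt c v t b d → Link lt c u t a d := by
    intro N
    induction N with
    | zero => intro u v t a b d hu; omega
    | succ N ih =>
      intro u v t a b d hu hv ht h1 h2
      have huv := h.lt_of_link h1
      have hvt := h.lt_of_link h2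
      have hut := h.trans huv hvt
      have n1 := h.ne huv
      have n2 := h.ne hvt
      have n3 := h.ne hut
      by_cases huN : u = N
      · obtain ⟨s, m, hs, hc, hsv⟩ := link_succ_inv h1 (by omega)
        have hsu := hs.1
        rcases hsv with ⟨rfl, rfl⟩ | ⟨hsv, hl⟩
        · exact .succ hs (by omega) hvt hc h2
        · exact .succ hs (by omega) (h.trans hsv hvt) hc
            (ih s v t m b d (by omega) (by omega) (by omega) hl h2)
      by_cases htN : t = N
      · obtain ⟨p, m, hp, hc, hvp⟩ := link_pred_inv h2 (by omega)
        have hpt := hp.1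
        rcases hvp with ⟨rfl, rfl⟩ | ⟨hvp, hl⟩
        · exact .pred hp (by omega) huv h1 hc
        · exact .pred hp (by omega) (h.trans huv hvp)
            (ih u v p a b m (by omega) (by omega) (by omega) h1 hl) hc
      by_cases hvN : v = N
      · obtain ⟨p, m, hp, hcp, hup⟩ := link_pred_inv h1 (by omega)
        obtain ⟨s, m', hs, hcs, hst⟩ := link_succ_inv h2 (by omega)
        have hpv := hp.1
        have hsv := hs.1
        have hps := h.link_of_neighbours hp hs hcp hcs
        have hus : Link lt c u s a m' := by
          rcases hup with ⟨rfl, rfl⟩ | ⟨-, hl⟩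
          · exact hps
          · exact ih u p s a m m' (by omega) (by omega) (by omega) hl hps
        rcases hst with ⟨rfl, rfl⟩ | ⟨-, hl⟩
        · exact hus
        · exact ih u s t a m' d (by omega) (by omega) (by omega) hus hl
      · exact ih u v t a b d (by omega) (by omega) (by omega) h1 h2
  exact main (max (max u v) t + 1) u v t a b d (by omega) (by omega) (by omega) h1 h2

lemma link_matching {u v : ℕ} {a b : α} (hl : Link lt c u v a b) :
    ∃ φ : α → α, φ a = b ∧ Set.InjOn φ (A u) ∧ ∀ x ∈ A u, Link lt c u v x (φ x) := by
  induction hl with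
  | predBase h1 h2 =>
    obtain ⟨φ, h3, h4, h5⟩ := h.matching h1.2.1 h2
    exact ⟨φ, h3, h4, fun x hx => .predBase h1 (h5 x hx)⟩
  | succBase h1 h2 =>
    obtain ⟨φ, h3, h4, h5⟩ := h.matching h1.2.1 h2
    exact ⟨φ, h3, h4, fun x hx => .succBase h1 (h5 x hx)⟩
  | pred h1 h2 h3 _ h5 ih =>
    obtain ⟨φ, h6, h7, h8⟩ := ih
    obtain ⟨ψ, h9, h10, h11⟩ := h.matching h1.2.1 h5
    have hm := fun x hx => (h.mem_of_link (h8 x hx)).2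
    exact ⟨fun x => ψ (φ x), by simp [h6, h9], fun x hx y hy hxy =>
      h7 hx hy (h10 (hm x hx) (hm y hy) hxy),
      fun x hx => .pred h1 h2 h3 (h8 x hx) (h11 _ (hm x hx))⟩
  | succ h1 h2 h3 h4 _ ih =>
    obtain ⟨φ, h6, h7, h8⟩ := ih
    obtain ⟨ψ, h9, h10, h11⟩ := h.matching h1.2.1 h4
    have hm := fun x hx => (h.mem_c (h11 x hx)).2
    exact ⟨fun x => φ (ψ x), by simp [h6, h9], fun x hx y hy hxy =>
      h10 hx hy (h7 (hm x hx) (hm y hy) hxy),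
      fun x hx => .succ h1 h2 h3 (h11 x hx) (h8 _ (hm x hx))⟩

lemma exists_link_matching {u v : ℕ} (huv : lt u v) :
    ∃ φ : α → α, Set.InjOn φ (A u) ∧ ∀ x ∈ A u, Link lt c u v x (φ x) := by
  rcases lt_or_gt_of_ne (h.ne huv) with hlt | hlt
  · obtain ⟨p, hp, hup⟩ := h.exists_isPred huv hlt
    obtain ⟨ψ, h10, h11⟩ := h.exists_matching hp.2.1
    rcases hup with rfl | hup
    · exact ⟨ψ, h10, fun x hx => .predBase hp (h11 x hx)⟩
    have hpv := hp.1
    obtain ⟨φ, h7, h8⟩ := exists_link_matching hup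
    have hm := fun x hx => (h.mem_of_link (h8 x hx)).2
    exact ⟨fun x => ψ (φ x), fun x hx y hy hxy =>
      h7 hx hy (h10 (hm x hx) (hm y hy) hxy),
      fun x hx => .pred hp hlt hup (h8 x hx) (h11 _ (hm x hx))⟩
  · obtain ⟨s, hs, hsv⟩ := h.dual.exists_isPred huv hlt
    have hs : IsSucc lt s u := hs
    obtain ⟨ψ, h10, h11⟩ := h.exists_matching hs.2.1
    rcases hsv with rfl | hsv
    · exact ⟨ψ, h10, fun x hx => .succBase hs (h11 x hx)⟩
    have hsu := hs.1
    obtain ⟨φ, h7, h8⟩ := exists_link_matching hsv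
    have hm := fun x hx => (h.mem_c (h11 x hx)).2
    exact ⟨fun x => φ (ψ x), fun x hx y hy hxy =>
      h10 hx hy (h7 (hm x hx) (hm y hy) hxy),
      fun x hx => .succ hs hlt hsv (h11 x hx) (h8 _ (hm x hx))⟩
  termination_by max u v

/-- If all levels after `t` up to `r` are younger than `t`, then the relation
between a level before `t` and `r` factors through `t`. -/
lemma link_interpolate {s t r : ℕ} {x y : α} (hl : Link lt c s r x y) (hst : s = t ∨ lt s t)
    (htr : lt t r) (hyoung : ∀ q, lt t q → (q = r ∨ lt q r) → t < q) :
    ∃ z ∈ A t, ((s = t ∧ x = z) ∨ Link lt c s t x z) ∧ Link lt c t r z y := by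
  rcases hst with rfl | hst
  · exact ⟨x, (h.mem_of_link hl).1, Or.inl ⟨rfl, rfl⟩, hl⟩
  have main : ∀ N s r (x y : α), s < N → r < N → Link lt c s r x y → lt s t → lt t r →
      (∀ q, lt t q → (q = r ∨ lt q r) → t < q) →
      ∃ z ∈ A t, Link lt c s t x z ∧ Link lt c t r z y := by
    intro N
    induction N with
    | zero => intro s r x y hs; omega
    | succ N ih =>
      intro s r x y hsN hrN hl hst htr hyoung
      have htr' := hyoung r htr (Or.inl rfl)
      rcases lt_or_gt_of_ne (h.ne (h.lt_of_link hl)) with hlt | hlt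
      · obtain ⟨p, m, hp, hc, hsp⟩ := link_pred_inv hl hlt
        have hpr := hp.1
        have htp := hp.2.2 t htr' htr
        rcases hsp with ⟨rfl, rfl⟩ | ⟨-, hl'⟩
        · rcases htp with rfl | htp
          · exact absurd hst (h.irrefl _)
          · exact absurd hst (h.asymm htp)
        rcases htp with rfl | htp
        · exact ⟨m, (h.mem_of_link hl').2, hl', .predBase hp hc⟩
        · obtain ⟨z, hz, h1, h2⟩ := ih s p x m (by omega) (by omega) hl' hst htp
            fun q hq hqp => hyoung q hq (Or.inr (by
              rcases hqp with rfl | hqp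
              · exact hp.2.1
              · exact h.trans hqp hp.2.1))
          exact ⟨z, hz, h1, h.link_trans h2 (.predBase hp hc)⟩
      · obtain ⟨q, m, hq, hc, hqr⟩ := link_succ_inv hl hlt
        have hqs := hq.1
        have hqt := hq.2.2 t (by omega) hst
        rcases hqr with ⟨rfl, rfl⟩ | ⟨-, hl'⟩
        · rcases hqt with rfl | hqt
          · exact absurd htr (h.irrefl _)
          · exact absurd htr (h.asymm hqt)
        rcases hqt with rfl | hqt
        · exact ⟨m, (h.mem_c hc).2, .succBase hq hc, hl'⟩
        · obtain ⟨z, hz, h1, h2⟩ := ih q r m y (by omega) (by omega) hl' hqt htr hyoung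
          exact ⟨z, hz, h.link_trans (.succBase hq hc) h1, h2⟩
  obtain ⟨z, hz, h1, h2⟩ := main (max s r + 1) s r x y (by omega) (by omega) hl hst htr hyoung
  exact ⟨z, hz, Or.inr h1, h2⟩

lemma link_interpolate' {s t r : ℕ} {x y : α} (hl : Link lt c s r x y) (hst : lt s t)
    (htr : t = r ∨ lt t r) (hyoung : ∀ q, (q = s ∨ lt s q) → lt q t → t < q) :
    ∃ z ∈ A t, Link lt c s t x z ∧ ((t = r ∧ z = y) ∨ Link lt c t r z y) := by
  obtain ⟨z, hz, h1, h2⟩ := h.dual.link_interpolate hl.flip (t := t)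
    (htr.imp_left Eq.symm) hst fun q h1 h2 => hyoung q h2 h1
  exact ⟨z, hz, h2.flip, h1.imp (fun h => ⟨h.1.symm, h.2.symm⟩) Link.flip⟩

/-- Every set of levels can be labelled consistently with `k` labels, so that elements with the
same label are linked: compose perfect matchings along the levels. -/
lemma exists_labels (S : Finset ℕ) (hS : ∀ u ∈ S, u ∈ L) :
    ∃ l : ℕ → α → ℕ, (∀ u ∈ S, Set.InjOn (l u) (A u) ∧ ∀ a ∈ A u, l u a < k) ∧
      ∀ u ∈ S, ∀ v ∈ S, lt u v → ∀ a ∈ A u, ∀ b ∈ A v, l u a = l v b → Link lt c u v a b := by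
  induction hn : S.card generalizing S with
  | zero =>
    rw [Finset.card_eq_zero] at hn
    subst hn
    exact ⟨fun _ _ => 0, by simp, by simp⟩
  | succ n ih =>
    obtain ⟨t, ht, htmax⟩ := h.exists_last S hS (Finset.card_pos.1 (by omega))
    have hS' : ∀ u ∈ S.erase t, u ∈ L := fun u hu => hS u (Finset.mem_of_mem_erase hu)
    obtain ⟨l, hl1, hl2⟩ := ih (S.erase t) hS' (by rw [Finset.card_erase_of_mem ht]; omega)
    have hlast : ∀ u ∈ S, u ≠ t → lt u t := fun u hu hut => (htmax u hu).resolve_left hut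
    -- it suffices to label the last level compatibly with the others
    suffices hlt : ∃ f : α → ℕ, Set.InjOn f (A t) ∧ (∀ b ∈ A t, f b < k) ∧
        ∀ u ∈ S.erase t, ∀ a ∈ A u, ∀ b ∈ A t, l u a = f b → Link lt c u t a b by
      obtain ⟨f, hf1, hf2, hf3⟩ := hlt
      refine ⟨Function.update l t f, fun u hu => ?_, fun u hu v hv huv => ?_⟩
      · by_cases hut : u = t
        · subst hut
          rw [Function.update_self]
          exact ⟨hf1, hf2⟩
        · rw [Function.update_of_ne hut]
          exact hl1 u (Finset.mem_erase.2 ⟨hut, hu⟩)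
      · have hut : u ≠ t := by
          rintro rfl
          rcases htmax v hv with rfl | hvt
          · exact h.irrefl _ huv
          · exact h.asymm huv hvt
        rw [Function.update_of_ne hut]
        by_cases hvt : v = t
        · subst hvt
          rw [Function.update_self]
          exact hf3 u (Finset.mem_erase.2 ⟨hut, hu⟩)
        · rw [Function.update_of_ne hvt]
          exact hl2 u (Finset.mem_erase.2 ⟨hut, hu⟩) v (Finset.mem_erase.2 ⟨hvt, hv⟩) huv
    rcases (S.erase t).eq_empty_or_nonempty with he | hne
    · obtain ⟨e⟩ : Nonempty ((A t) ≃ Fin k) := ⟨(A t).equivFinOfCardEq (h.card (hS t ht))⟩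
      refine ⟨fun b => if hb : b ∈ A t then e ⟨b, hb⟩ else 0, fun x hx y hy hxy => ?_,
        fun b hb => ?_, by simp [he]⟩
      · have hx' : x ∈ A t := hx
        have hy' : y ∈ A t := hy
        simp only [hx', hy', dif_pos] at hxy
        exact congrArg Subtype.val (e.injective (Fin.val_injective hxy))
      · simp only [hb, dif_pos]
        exact (e ⟨b, hb⟩).isLt
    · obtain ⟨p, hp, hpmax⟩ := h.exists_last (S.erase t) hS' hne
      obtain ⟨hpt, hpS⟩ := Finset.mem_erase.1 hp
      obtain ⟨φ, hφ1, hφ2⟩ := h.exists_link_matching (hlast p hpS hpt)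
      obtain ⟨ψ, -, hψ2, hψ3⟩ := exists_inverse_matching (T := A t)
        ((h.card (hS p hpS)).trans (h.card (hS t ht)).symm) hφ1
        fun x hx => (h.mem_of_link (hφ2 x hx)).2
      have hl := hl1 p hp
      refine ⟨fun b => l p (ψ b), fun x hx y hy hxy =>
        hψ2 hx hy (hl.1 (hψ3 x hx).1 (hψ3 y hy).1 hxy), fun b hb => hl.2 _ (hψ3 b hb).1, ?_⟩
      intro u hu a ha b hb hab
      have hb' := hφ2 _ (hψ3 b hb).1
      rw [(hψ3 b hb).2] at hb'
      rcases hpmax u hu with rfl | hup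
      · rwa [hl.1 ha (hψ3 b hb).1 hab]
      · exact h.link_trans (hl2 u hu p hp hup a ha _ (hψ3 b hb).1 hab) hb'

end IsLevelSystem

end Levels

/-! ### Ladders in level systems -/

section Nodes

open scoped Classical

variable {α : Type*} {L : Set ℕ} {lt : ℕ → ℕ → Prop} {c : ℕ → ℕ → α → α → Prop}
  {A : ℕ → Finset α} {k : ℕ}

/-- The elements of the levels named by numbers below `n`, each level contributing its own copies
of elements. -/
structure Node (h : IsLevelSystem L lt c A k) (n : ℕ) where
  /-- the level -/
  lev : ℕ
  /-- the element of the level -/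
  el : α
  lev_lt : lev < n
  lev_mem : lev ∈ L
  el_mem : el ∈ A lev

namespace Node

variable {h : IsLevelSystem L lt c A k} {n : ℕ}

lemma ext_iff' {p q : Node h n} : p = q ↔ p.lev = q.lev ∧ p.el = q.el := by
  cases p; cases q; simp

/-- Elements of different levels are compared by `Link`, those of the same level are
incomparable. -/
instance : PartialOrder (Node h n) where
  le p q := p = q ∨ Link lt c p.lev q.lev p.el q.el
  le_refl _ := Or.inl rfl
  le_trans p q r hpq hqr := by
    rcases hpq with rfl | hpq
    · exact hqr
    rcases hqr with rfl | hqr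
    · exact Or.inr hpq
    · exact Or.inr (h.link_trans hpq hqr)
  le_antisymm p q hpq hqp := by
    rcases hpq with rfl | hpq
    · rfl
    rcases hqp with rfl | hqp
    · rfl
    · exact absurd (h.lt_of_link hqp) (h.asymm (h.lt_of_link hpq))

lemma le_iff {p q : Node h n} : p ≤ q ↔ p = q ∨ Link lt c p.lev q.lev p.el q.el := Iff.rfl

lemma lt_iff {p q : Node h n} : p < q ↔ Link lt c p.lev q.lev p.el q.el := by
  rw [lt_iff_le_and_ne, le_iff]
  refine ⟨fun hpq => hpq.1.resolve_left hpq.2, fun hl => ⟨Or.inr hl, ?_⟩⟩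
  rintro rfl
  exact h.irrefl _ (h.lt_of_link hl)

lemma lev_lt_of_lt {p q : Node h n} (hpq : p < q) : lt p.lev q.lev := h.lt_of_link (lt_iff.1 hpq)

lemma lev_le_of_le {p q : Node h n} (hpq : p ≤ q) : p.lev = q.lev ∨ lt p.lev q.lev := by
  rcases hpq.eq_or_lt with rfl | hpq
  · exact Or.inl rfl
  · exact Or.inr (lev_lt_of_lt hpq)

/-- The nodes are covered by `k` chains. -/
lemma exists_cover (h : IsLevelSystem L lt c A k) (n : ℕ) :
    ∃ cov : Node h n → Fin k, ∀ x y, cov x = cov y → x ≤ y ∨ y ≤ x := by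
  obtain ⟨l, hl1, hl2⟩ := h.exists_labels {u ∈ Finset.range n | u ∈ L}
    fun u hu => (Finset.mem_filter.1 hu).2
  have hmem : ∀ p : Node h n, p.lev ∈ ({u ∈ Finset.range n | u ∈ L} : Finset ℕ) := fun p =>
    Finset.mem_filter.2 ⟨Finset.mem_range.2 p.lev_lt, p.lev_mem⟩
  refine ⟨fun p => ⟨l p.lev p.el, (hl1 _ (hmem p)).2 _ p.el_mem⟩, fun x y hxy => ?_⟩
  have hxy : l x.lev x.el = l y.lev y.el := congrArg Fin.val hxy
  by_cases hlev : x.lev = y.lev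
  · refine Or.inl (Or.inl (ext_iff'.2 ⟨hlev, ?_⟩))
    rw [← hlev] at hxy
    exact (hl1 _ (hmem x)).1 x.el_mem (hlev ▸ y.el_mem) hxy
  · rcases h.total x.lev_mem y.lev_mem hlev with hlt | hlt
    · exact Or.inl (Or.inr (hl2 _ (hmem x) _ (hmem y) hlt _ x.el_mem _ y.el_mem hxy))
    · exact Or.inr (Or.inr (hl2 _ (hmem y) _ (hmem x) hlt _ y.el_mem _ x.el_mem hxy.symm))

/-- The elements of the level `v` that are equal to or above `p`. -/
noncomputable def above (p : Node h n) (v : ℕ) : Finset α :=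
  {b ∈ A v | (p.lev = v ∧ p.el = b) ∨ Link lt c p.lev v p.el b}

lemma el_mem_above {p q : Node h n} : q.el ∈ p.above q.lev ↔ p ≤ q := by
  rw [above, Finset.mem_filter, le_iff, ext_iff']
  exact and_iff_right q.el_mem

lemma mem_above_of_link {p : Node h n} {u v : ℕ} {a b : α} (ha : a ∈ p.above u)
    (hab : Link lt c u v a b) : b ∈ p.above v := by
  obtain ⟨-, ⟨rfl, rfl⟩ | hl⟩ := Finset.mem_filter.1 ha
  · exact Finset.mem_filter.2 ⟨(h.mem_of_link hab).2, Or.inr hab⟩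
  · exact Finset.mem_filter.2 ⟨(h.mem_of_link hab).2, Or.inr (h.link_trans hl hab)⟩

lemma card_above_le_of_lt (p : Node h n) {u v : ℕ} (huv : u = v ∨ lt u v) :
    (p.above u).card ≤ (p.above v).card := by
  rcases huv with rfl | huv
  · rfl
  obtain ⟨φ, h1, h2⟩ := h.exists_link_matching huv
  have hsub : ∀ a ∈ p.above u, a ∈ A u := fun a ha => (Finset.mem_filter.1 ha).1
  exact Finset.card_le_card_of_injOn φ (fun a ha => mem_above_of_link ha (h2 a (hsub a ha)))
    (h1.mono hsub)

lemma card_above_lt_of_lt {p x z : Node h n} (hx : ¬ p ≤ x) (hxz : x < z) (hz : p ≤ z) :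
    (p.above x.lev).card < (p.above z.lev).card := by
  obtain ⟨φ, h0, h1, h2⟩ := h.link_matching (lt_iff.1 hxz)
  rw [← el_mem_above] at hx hz
  have hsub : ∀ a ∈ insert x.el (p.above x.lev), a ∈ A x.lev := by
    intro a ha
    rcases Finset.mem_insert.1 ha with rfl | ha
    · exact x.el_mem
    · exact (Finset.mem_filter.1 ha).1
  have := Finset.card_le_card_of_injOn φ (s := insert x.el (p.above x.lev))
    (t := p.above z.lev) (fun a ha => by
      rcases Finset.mem_insert.1 ha with rfl | ha'
      · rw [h0]; exact hz
      · exact mem_above_of_link ha' (h2 a (hsub a ha))) (h1.mono hsub)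
  rwa [Finset.card_insert_of_notMem hx] at this

lemma card_above_le (p : Node h n) {v : ℕ} (hv : v ∈ L) : (p.above v).card ≤ k :=
  (Finset.card_filter_le _ _).trans (h.card hv).le

/-- The oldest of the levels in the interval spanned by a comparable pair. -/
lemma exists_oldest {x y : Node h n} (hxy : x < y) :
    ∃ t ∈ L, (x.lev = t ∨ lt x.lev t) ∧ (t = y.lev ∨ lt t y.lev) ∧
      ∀ q, (x.lev = q ∨ lt x.lev q) → (q = y.lev ∨ lt q y.lev) → t ≤ q := by
  have hex : ∃ t, t ∈ L ∧ (x.lev = t ∨ lt x.lev t) ∧ (t = y.lev ∨ lt t y.lev) :=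
    ⟨x.lev, x.lev_mem, Or.inl rfl, Or.inr (lev_lt_of_lt hxy)⟩
  obtain ⟨h1, h2, h3⟩ := Nat.find_spec hex
  refine ⟨Nat.find hex, h1, h2, h3, fun q hq1 hq2 => Nat.find_min' hex ⟨?_, hq1, hq2⟩⟩
  rcases hq2 with rfl | hq2
  · exact y.lev_mem
  · exact h.mem_left hq2

lemma isLadder_mono {X : Type*} [PartialOrder X] {S T : Finset (X × X)} (hT : IsLadder T)
    (hST : S ⊆ T) : IsLadder S :=
  ⟨fun p hp => hT.1 p (hST hp), fun p hp q hq => hT.2 p (hST hp) q (hST hq)⟩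

lemma isLadder_cases {X : Type*} [PartialOrder X] {T : Finset (X × X)} (hT : IsLadder T)
    {p q : X × X} (hp : p ∈ T) (hq : q ∈ T) : p = q ∨ (p.1 < q.1 ∧ p.2 < q.2 ∧ ¬ q.1 ≤ p.2) ∨
      (q.1 < p.1 ∧ q.2 < p.2 ∧ ¬ p.1 ≤ q.2) := by
  by_cases hpq : p = q
  · exact Or.inl hpq
  rcases hT.2 p hp q hq hpq with ⟨h1, h2, h3⟩ | ⟨h1, h2, h3⟩
  · exact Or.inr (Or.inl ⟨h1, h2, h3.1⟩)
  · exact Or.inr (Or.inr ⟨h1, h2, h3.1⟩)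

lemma isLadder_isChain {X : Type*} [PartialOrder X] {T : Finset (X × X)} (hT : IsLadder T) :
    IsChain (· ≤ ·) ((T.image Prod.fst : Finset X) : Set X) := by
  intro a ha b hb _
  obtain ⟨p, hp, rfl⟩ := Finset.mem_image.1 (Finset.mem_coe.1 ha)
  obtain ⟨q, hq, rfl⟩ := Finset.mem_image.1 (Finset.mem_coe.1 hb)
  rcases isLadder_cases hT hp hq with rfl | ⟨h1, -⟩ | ⟨h1, -⟩
  · exact Or.inl le_rfl
  · exact Or.inl h1.le
  · exact Or.inr h1.le

lemma isLadder_exists_first {X : Type*} [PartialOrder X] {T : Finset (X × X)} (hT : IsLadder T)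
    (hne : T.Nonempty) : ∃ p ∈ T, ∀ q ∈ T, q = p ∨ (p.1 < q.1 ∧ p.2 < q.2 ∧ ¬ q.1 ≤ p.2) := by
  obtain ⟨x, hx, hmin⟩ := exists_least_of_isChain (isLadder_isChain hT) (hne.image _)
  obtain ⟨p, hp, rfl⟩ := Finset.mem_image.1 hx
  refine ⟨p, hp, fun q hq => ?_⟩
  rcases isLadder_cases hT hq hp with h1 | ⟨h1, -⟩ | h1
  · exact Or.inl h1
  · exact absurd (hmin q.1 (Finset.mem_image_of_mem _ hq)) h1.not_ge
  · exact Or.inr h1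

lemma isLadder_exists_last {X : Type*} [PartialOrder X] {T : Finset (X × X)} (hT : IsLadder T)
    (hne : T.Nonempty) : ∃ p ∈ T, ∀ q ∈ T, q = p ∨ (q.1 < p.1 ∧ q.2 < p.2 ∧ ¬ p.1 ≤ q.2) := by
  obtain ⟨x, hx, hmin⟩ := exists_greatest_of_isChain (isLadder_isChain hT) (hne.image _)
  obtain ⟨p, hp, rfl⟩ := Finset.mem_image.1 hx
  refine ⟨p, hp, fun q hq => ?_⟩
  rcases isLadder_cases hT hq hp with h1 | h1 | ⟨h1, -⟩
  · exact Or.inl h1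
  · exact Or.inr h1
  · exact absurd (hmin q.1 (Finset.mem_image_of_mem _ hq)) h1.not_ge

/-- If all rungs of a ladder cross the level `t`, and the levels after `t` up to those of the
upper leg are younger than `t`, then the rungs factor through `t`. An element of `t` on the rung
`s` is below `s.2` but not below the upper ends of the rungs before `s`; hence the upper ends are
above more and more of the `k` elements of `t`. -/
lemma card_ladder_left {T : Finset (Node h n × Node h n)} (hT : IsLadder T) {t : ℕ} (ht : t ∈ L)
    (h1 : ∀ r ∈ T, r.1.lev = t ∨ lt r.1.lev t) (h2 : ∀ r ∈ T, lt t r.2.lev)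
    (hyoung : ∀ r ∈ T, ∀ q, lt t q → (q = r.2.lev ∨ lt q r.2.lev) → t < q) : T.card ≤ k := by
  let N : Node h n × Node h n → Finset α := fun r => {z ∈ A t | Link lt c t r.2.lev z r.2.el}
  have key : ∀ r ∈ T, ∃ z ∈ N r, (r.1.lev = t ∧ r.1.el = z) ∨ Link lt c r.1.lev t r.1.el z := by
    intro r hr
    obtain ⟨z, hz, h3, h4⟩ := h.link_interpolate (lt_iff.1 (hT.1 r hr)) (h1 r hr) (h2 r hr)
      (hyoung r hr)
    exact ⟨z, Finset.mem_filter.2 ⟨hz, h4⟩, h3⟩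
  have hlt : ∀ r ∈ T, ∀ s ∈ T, r.1 < s.1 → r.2 < s.2 → ¬ s.1 ≤ r.2 →
      (N r).card < (N s).card := by
    intro r hr s hs _ h4 h5
    refine Finset.card_lt_card (Finset.ssubset_iff_subset_ne.2 ⟨fun z hz => ?_, fun he => h5 ?_⟩)
    · obtain ⟨hz1, hz2⟩ := Finset.mem_filter.1 hz
      exact Finset.mem_filter.2 ⟨hz1, h.link_trans hz2 (lt_iff.1 h4)⟩
    · obtain ⟨z, hz, hsz⟩ := key s hs
      rw [← he] at hz
      have hz2 := (Finset.mem_filter.1 hz).2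
      rcases hsz with ⟨rfl, rfl⟩ | hsz
      · exact Or.inr hz2
      · exact Or.inr (h.link_trans hsz hz2)
  have := Finset.card_le_card_of_injOn (s := T) (t := Finset.Icc 1 k) (fun r => (N r).card)
    (fun r hr => Finset.mem_coe.2 (Finset.mem_Icc.2 ⟨Finset.card_pos.2
      (let ⟨z, hz, _⟩ := key r hr; ⟨z, hz⟩),
      (Finset.card_filter_le _ _).trans (h.card ht).le⟩)) (by
    intro r hr s hs hrs
    have hrs : (N r).card = (N s).card := hrs
    rcases isLadder_cases hT hr hs with he | ⟨h3, h4, h5⟩ | ⟨h3, h4, h5⟩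
    · exact he
    · exact absurd hrs (hlt r hr s hs h3 h4 h5).ne
    · exact absurd hrs (hlt s hs r hr h3 h4 h5).ne')
  simpa using this

/-- If all rungs of a ladder cross the level `t`, and the levels before `t` down to those of the
lower leg are younger than `t`, then the lower ends are below fewer and fewer of the `k` elements
of `t`. -/
lemma card_ladder_right {T : Finset (Node h n × Node h n)} (hT : IsLadder T) {t : ℕ} (ht : t ∈ L)
    (h1 : ∀ r ∈ T, t = r.2.lev ∨ lt t r.2.lev) (h2 : ∀ r ∈ T, lt r.1.lev t)
    (hyoung : ∀ r ∈ T, ∀ q, (q = r.1.lev ∨ lt r.1.lev q) → lt q t → t < q) : T.card ≤ k := by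
  let N : Node h n × Node h n → Finset α := fun r => {z ∈ A t | Link lt c r.1.lev t r.1.el z}
  have key : ∀ r ∈ T, ∃ z ∈ N r, (t = r.2.lev ∧ z = r.2.el) ∨ Link lt c t r.2.lev z r.2.el := by
    intro r hr
    obtain ⟨z, hz, h3, h4⟩ := h.link_interpolate' (lt_iff.1 (hT.1 r hr)) (h2 r hr) (h1 r hr)
      (hyoung r hr)
    exact ⟨z, Finset.mem_filter.2 ⟨hz, h3⟩, h4⟩
  have hlt : ∀ r ∈ T, ∀ s ∈ T, r.1 < s.1 → r.2 < s.2 → ¬ s.1 ≤ r.2 →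
      (N s).card < (N r).card := by
    intro r hr s hs h4 _ h5
    refine Finset.card_lt_card (Finset.ssubset_iff_subset_ne.2 ⟨fun z hz => ?_, fun he => h5 ?_⟩)
    · obtain ⟨hz1, hz2⟩ := Finset.mem_filter.1 hz
      exact Finset.mem_filter.2 ⟨hz1, h.link_trans (lt_iff.1 h4) hz2⟩
    · obtain ⟨z, hz, hzr⟩ := key r hr
      rw [← he] at hz
      have hz2 := (Finset.mem_filter.1 hz).2
      rcases hzr with ⟨rfl, rfl⟩ | hzr
      · exact Or.inr hz2
      · exact Or.inr (h.link_trans hz2 hzr)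
  have := Finset.card_le_card_of_injOn (s := T) (t := Finset.Icc 1 k) (fun r => (N r).card)
    (fun r hr => Finset.mem_coe.2 (Finset.mem_Icc.2 ⟨Finset.card_pos.2
      (let ⟨z, hz, _⟩ := key r hr; ⟨z, hz⟩),
      (Finset.card_filter_le _ _).trans (h.card ht).le⟩)) (by
    intro r hr s hs hrs
    have hrs : (N r).card = (N s).card := hrs
    rcases isLadder_cases hT hr hs with he | ⟨h3, h4, h5⟩ | ⟨h3, h4, h5⟩
    · exact he
    · exact absurd hrs (hlt r hr s hs h3 h4 h5).ne'
    · exact absurd hrs (hlt s hs r hr h3 h4 h5).ne)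
  simpa using this

/-- A ladder is short if its whole lower leg is on levels before those of its upper leg. The oldest
level spanned by a rung is then before the whole upper leg or after the whole lower leg. In the
first case the last rung supplies the level for `card_ladder_left`, in the second case
the first rung supplies the level for `card_ladder_right`. -/
lemma card_ladder_of_separated {T : Finset (Node h n × Node h n)} (hT : IsLadder T)
    (hsep : ∀ r ∈ T, ∀ s ∈ T, lt r.1.lev s.2.lev) : T.card ≤ 2 * k := by
  have hold : ∀ r : Node h n × Node h n, ∃ t, r ∈ T → t ∈ L ∧
      (r.1.lev = t ∨ lt r.1.lev t) ∧ (t = r.2.lev ∨ lt t r.2.lev) ∧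
      ∀ q, (r.1.lev = q ∨ lt r.1.lev q) → (q = r.2.lev ∨ lt q r.2.lev) → t ≤ q := by
    intro r
    by_cases hr : r ∈ T
    · obtain ⟨t, ht⟩ := exists_oldest (hT.1 r hr)
      exact ⟨t, fun _ => ht⟩
    · exact ⟨0, fun h' => absurd h' hr⟩
  choose t ht using hold
  have htrans : ∀ {a b d : ℕ}, (a = b ∨ lt a b) → (b = d ∨ lt b d) → (a = d ∨ lt a d) := by
    rintro a b d (rfl | h1) (rfl | h2)
    · exact Or.inl rfl
    · exact Or.inr h2
    · exact Or.inr h1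
    · exact Or.inr (h.trans h1 h2)
  have hright : ∀ r ∈ T, ¬ (∀ s ∈ T, lt (t r) s.2.lev) → ∀ s ∈ T, lt s.1.lev (t r) := by
    intro r hr hn s hs
    push Not at hn
    obtain ⟨s', hs', hn⟩ := hn
    by_cases he : t r = s'.2.lev
    · rw [he]; exact hsep s hs s' hs'
    · exact h.trans (hsep s hs s' hs') ((h.total (ht r hr).1 s'.2.lev_mem he).resolve_left hn)
  have hl : ({r ∈ T | ∀ s ∈ T, lt (t r) s.2.lev}).card ≤ k := by
    rcases Finset.eq_empty_or_nonempty ({r ∈ T | ∀ s ∈ T, lt (t r) s.2.lev}) with he | hne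
    · rw [he]; simp
    have hT' := isLadder_mono hT (Finset.filter_subset (fun r => ∀ s ∈ T, lt (t r) s.2.lev) T)
    obtain ⟨a, ha, hlast⟩ := isLadder_exists_last hT' hne
    obtain ⟨haT, hal⟩ := Finset.mem_filter.1 ha
    obtain ⟨ha1, ha2, ha3, ha4⟩ := ht a haT
    refine card_ladder_left hT' ha1 (fun r hr => ?_) (fun r hr => hal r (Finset.mem_filter.1 hr).1)
      fun r hr q h1 h2 => lt_of_le_of_ne (ha4 q (Or.inr ?_) ?_) (h.ne h1)
    · rcases hlast r hr with rfl | ⟨h1, -⟩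
      · exact ha2
      · exact htrans (lev_le_of_le h1.le) ha2
    · rcases ha2 with he | h'
      · exact he ▸ h1
      · exact h.trans h' h1
    · rcases hlast r hr with rfl | ⟨-, h3, -⟩
      · exact h2
      · exact htrans h2 (lev_le_of_le h3.le)
  have hr : ({r ∈ T | ¬ ∀ s ∈ T, lt (t r) s.2.lev}).card ≤ k := by
    rcases Finset.eq_empty_or_nonempty ({r ∈ T | ¬ ∀ s ∈ T, lt (t r) s.2.lev}) with he | hne
    · rw [he]; simp
    have hT' := isLadder_mono hT (Finset.filter_subset (fun r => ¬ ∀ s ∈ T, lt (t r) s.2.lev) T)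
    obtain ⟨a, ha, hfirst⟩ := isLadder_exists_first hT' hne
    obtain ⟨haT, hal⟩ := Finset.mem_filter.1 ha
    obtain ⟨ha1, ha2, ha3, ha4⟩ := ht a haT
    refine card_ladder_right hT' ha1 (fun r hr => ?_)
      (fun r hr => hright a haT hal r (Finset.mem_filter.1 hr).1)
      fun r hr q h1 h2 => lt_of_le_of_ne (ha4 q ?_ (Or.inr ?_)) (h.ne h2).symm
    · rcases hfirst r hr with rfl | ⟨-, h1, -⟩
      · exact ha3
      · exact htrans ha3 (lev_le_of_le h1.le)
    · have h1 := h1.imp_left Eq.symm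
      rcases hfirst r hr with rfl | ⟨h3, -⟩
      · exact h1
      · exact htrans (lev_le_of_le h3.le) h1
    · rcases ha3 with he | h'
      · exact he ▸ h2
      · exact h.trans h2 h'
  have := Finset.card_filter_add_card_filter_not (s := T) (fun r => ∀ s ∈ T, lt (t r) s.2.lev)
  omega

/-- Ladders among the nodes of a level system are short. Moving up along the upper leg, the number
of elements of a level that are above the first upper end does not decrease, and it increases
between two rungs that are not separated by the levels. -/
theorem card_ladder_le {T : Finset (Node h n × Node h n)} (hT : IsLadder T) :
    T.card ≤ 2 * k ^ 2 := by
  rcases T.eq_empty_or_nonempty with rfl | hne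
  · simp
  obtain ⟨o, ho, hfirst⟩ := isLadder_exists_first hT hne
  have hge : ∀ r ∈ T, o.2 ≤ r.2 := by
    intro r hr
    rcases hfirst r hr with rfl | ⟨-, h2, -⟩
    · exact le_rfl
    · exact h2.le
  -- the number of elements of the level of `r.2` that are above the upper end of the first rung
  let f : Node h n × Node h n → ℕ := fun r => (o.2.above r.2.lev).card
  have hf : ∀ r ∈ T, f r ∈ Finset.Icc 1 k := fun r hr => Finset.mem_Icc.2
    ⟨Finset.card_pos.2 ⟨r.2.el, el_mem_above.2 (hge r hr)⟩, card_above_le _ r.2.lev_mem⟩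
  have := Finset.card_le_mul_card_image_of_maps_to hf (2 * k) fun i _ => by
    refine card_ladder_of_separated (isLadder_mono hT (Finset.filter_subset _ T)) ?_
    intro s hs r hr
    obtain ⟨hsT, hfs⟩ := Finset.mem_filter.1 hs
    obtain ⟨hrT, hfr⟩ := Finset.mem_filter.1 hr
    rcases isLadder_cases hT hsT hrT with rfl | ⟨h1, -⟩ | ⟨h1, h2, h3⟩
    · exact lev_lt_of_lt (hT.1 s hsT)
    · exact lev_lt_of_lt (h1.trans (hT.1 r hrT))
    · by_contra hn
      have hle : r.2.lev = s.1.lev ∨ lt r.2.lev s.1.lev := by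
        by_cases he : s.1.lev = r.2.lev
        · exact Or.inl he.symm
        · exact Or.inr ((h.total s.1.lev_mem r.2.lev_mem he).resolve_left hn)
      have h4 := card_above_le_of_lt o.2 hle
      have h5 : ¬ o.2 ≤ s.1 := fun h' => by
        by_cases he : s = o
        · subst he
          exact absurd (h'.trans_lt (hT.1 s hsT)) (lt_irrefl _)
        · rcases hT.2 s hsT o ho he with ⟨h6, -⟩ | ⟨-, -, h6⟩
          · rcases hfirst s hsT with h7 | ⟨h7, -⟩
            · exact he h7
            · exact h6.asymm h7
          · exact h6.2 h'
      have h6 := card_above_lt_of_lt h5 (hT.1 s hsT) (hge s hsT)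
      have : f s = f r := hfs.trans hfr.symm
      simp only [f] at this
      omega
  calc T.card ≤ _ := this
    _ = 2 * k ^ 2 := by simp; ring

end Node

end Nodes

/-! ### Maximum antichains -/

section MaximumAntichains

open scoped Classical

variable {X : Type*} {le : X → X → Prop}

/-- The relation `le` is a partial order. -/
structure IsOrder (le : X → X → Prop) : Prop where
  refl : ∀ a, le a a
  trans : ∀ {a b d}, le a b → le b d → le a d
  antisymm : ∀ {a b}, le a b → le b a → a = b

lemma IsOrder.flip (h : IsOrder le) : IsOrder (fun a b => le b a) where
  refl := h.refl
  trans := fun h1 h2 => h.trans h2 h1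
  antisymm := fun h1 h2 => h.antisymm h2 h1

/-- Each element of `S` is below some element of `T`. -/
def Dom (le : X → X → Prop) (S T : Finset X) : Prop := ∀ a ∈ S, ∃ b ∈ T, le a b

/-- `S` is an antichain of `k` elements in `W`, and `W` has no larger antichains. -/
structure IsMaxAntichain (le : X → X → Prop) (W : Set X) (k : ℕ) (S : Finset X) : Prop where
  subset : ∀ a ∈ S, a ∈ W
  eq_of_le : ∀ {a b}, a ∈ S → b ∈ S → le a b → a = b
  card_eq : S.card = k
  card_le : ∀ T : Finset X, (∀ a ∈ T, a ∈ W) → (∀ a ∈ T, ∀ b ∈ T, le a b → a = b) → T.card ≤ k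

/-- The pair `(a, b)` belongs to a perfect matching of comparable pairs between `S` and `T`. -/
def Edge (le : X → X → Prop) (S T : Finset X) (a b : X) : Prop :=
  a ∈ S ∧ b ∈ T ∧ ∃ φ : X → X, φ a = b ∧ Set.InjOn φ S ∧ ∀ x ∈ S, φ x ∈ T ∧ le x (φ x)

/-- The maximal elements of the union of two antichains. -/
noncomputable def join (le : X → X → Prop) (S T : Finset X) : Finset X :=
  {x ∈ S ∪ T | ∀ y ∈ S ∪ T, le x y → x = y}

lemma join_comm (S T : Finset X) : join le S T = join le T S := by
  rw [join, join, Finset.union_comm]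

lemma Edge.comp (hle : IsOrder le) {S T U : Finset X} {a b d : X} (h1 : Edge le S T a b)
    (h2 : Edge le T U b d) : Edge le S U a d := by
  obtain ⟨ha, -, φ, h3, h4, h5⟩ := h1
  obtain ⟨-, hd, ψ, h6, h7, h8⟩ := h2
  exact ⟨ha, hd, fun x => ψ (φ x), by simp [h3, h6], fun x hx y hy hxy =>
    h4 hx hy (h7 (h5 x hx).1 (h5 y hy).1 hxy), fun x hx =>
      ⟨(h8 _ (h5 x hx).1).1, hle.trans (h5 x hx).2 (h8 _ (h5 x hx).1).2⟩⟩

lemma Edge.rel {S T : Finset X} {a b : X} (h : Edge le S T a b) : le a b := by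
  obtain ⟨ha, -, φ, h3, -, h5⟩ := h
  exact h3 ▸ (h5 a ha).2

lemma Dom.trans (hle : IsOrder le) {S T U : Finset X} (h1 : Dom le S T) (h2 : Dom le T U) :
    Dom le S U := by
  intro a ha
  obtain ⟨b, hb, hab⟩ := h1 a ha
  obtain ⟨d, hd, hbd⟩ := h2 b hb
  exact ⟨d, hd, hle.trans hab hbd⟩

namespace IsMaxAntichain

variable {W : Set X} {k : ℕ} {S T U : Finset X}

lemma flip (h : IsMaxAntichain le W k S) : IsMaxAntichain (fun a b => le b a) W k S where
  subset := h.subset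
  eq_of_le := fun ha hb hab => (h.eq_of_le hb ha hab).symm
  card_eq := h.card_eq
  card_le := fun T h1 h2 => h.card_le T h1 fun a ha b hb hab => (h2 b hb a ha hab).symm

lemma exists_comparable (h : IsMaxAntichain le W k S) {x : X} (hx : x ∈ W)
    (hle : IsOrder le) : ∃ a ∈ S, le a x ∨ le x a := by
  by_contra! hn
  have hxS : x ∉ S := fun hxS => (hn x hxS).1 (hle.refl x)
  have := h.card_le (insert x S) (fun a ha => by
    rcases Finset.mem_insert.1 ha with rfl | ha
    · exact hx
    · exact h.subset a ha) (fun a ha b hb hab => by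
    rcases Finset.mem_insert.1 ha with rfl | ha' <;> rcases Finset.mem_insert.1 hb with rfl | hb'
    · rfl
    · exact absurd hab (hn b hb').2
    · exact absurd hab (hn a ha').1
    · exact h.eq_of_le ha' hb' hab)
  rw [Finset.card_insert_of_notMem hxS, h.card_eq] at this
  omega

lemma dom_flip (hle : IsOrder le) (hS : IsMaxAntichain le W k S) (hT : IsMaxAntichain le W k T)
    (h : Dom le S T) : Dom (fun a b => le b a) T S := by
  intro b hb
  obtain ⟨a, ha, hab⟩ := hS.exists_comparable (hT.subset b hb) hle
  refine ⟨a, ha, hab.elim id fun hba => ?_⟩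
  obtain ⟨b', hb', hab'⟩ := h a ha
  rwa [hT.eq_of_le hb hb' (hle.trans hba hab')]

lemma eq_of_dom (hle : IsOrder le) (hS : IsMaxAntichain le W k S) (hT : IsMaxAntichain le W k T)
    (h1 : Dom le S T) (h2 : Dom le T S) : S = T := by
  refine Finset.eq_of_subset_of_card_le (fun a ha => ?_) (hT.card_eq.trans hS.card_eq.symm).le
  obtain ⟨b, hb, hab⟩ := h1 a ha
  obtain ⟨a', ha', hba'⟩ := h2 b hb
  obtain rfl := hS.eq_of_le ha ha' (hle.trans hab hba')
  rwa [hle.antisymm hab hba']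

lemma join_antichain {a b : X} (ha : a ∈ join le S T) (hb : b ∈ join le S T) (hab : le a b) :
    a = b :=
  (Finset.mem_filter.1 ha).2 b (Finset.mem_filter.1 hb).1 hab

lemma join_subset (hS : IsMaxAntichain le W k S) (hT : IsMaxAntichain le W k T) :
    ∀ a ∈ join le S T, a ∈ W := by
  intro a ha
  rcases Finset.mem_union.1 (Finset.mem_filter.1 ha).1 with ha | ha
  · exact hS.subset a ha
  · exact hT.subset a ha

/-- The maximal elements of the union of two maximum antichains form a maximum antichain, as
every element of the union is maximal or minimal, and those of the intersection are both. -/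
lemma isMaxAntichain_join (hle : IsOrder le) (hS : IsMaxAntichain le W k S)
    (hT : IsMaxAntichain le W k T) : IsMaxAntichain le W k (join le S T) := by
  have h1 : (join le S T).card ≤ k := hS.card_le _ (join_subset hS hT)
    fun a ha b hb => join_antichain ha hb
  have h2 : (join (fun a b => le b a) S T).card ≤ k := hS.flip.card_le _
    (join_subset hS.flip hT.flip) fun a ha b hb => join_antichain ha hb
  have h3 : S ∪ T ⊆ join le S T ∪ join (fun a b => le b a) S T := by
    intro x hx
    by_contra hn
    simp only [join, Finset.mem_union, Finset.mem_filter, not_or, not_and, not_forall] at hn hx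
    obtain ⟨y, hy, hxy, hne⟩ := hn.1 hx
    obtain ⟨z, hz, hzx, hne'⟩ := hn.2 hx
    rcases hx with hx | hx
    · have hy := hy.resolve_left fun hy => hne (hS.eq_of_le hx hy hxy)
      have hz := hz.resolve_left fun hz => hne' (hS.eq_of_le hz hx hzx).symm
      obtain rfl := hT.eq_of_le hz hy (hle.trans hzx hxy)
      exact hne (hle.antisymm hxy hzx)
    · have hy := hy.resolve_right fun hy => hne (hT.eq_of_le hx hy hxy)
      have hz := hz.resolve_right fun hz => hne' (hT.eq_of_le hz hx hzx).symm
      obtain rfl := hS.eq_of_le hz hy (hle.trans hzx hxy)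
      exact hne (hle.antisymm hxy hzx)
  have h4 : S ∩ T ⊆ join le S T ∩ join (fun a b => le b a) S T := by
    intro x hx
    obtain ⟨hxS, hxT⟩ := Finset.mem_inter.1 hx
    refine Finset.mem_inter.2 ⟨Finset.mem_filter.2 ⟨Finset.mem_union_left _ hxS,
      fun y hy hxy => ?_⟩, Finset.mem_filter.2 ⟨Finset.mem_union_left _ hxS, fun y hy hyx => ?_⟩⟩
    · rcases Finset.mem_union.1 hy with hy | hy
      · exact hS.eq_of_le hxS hy hxy
      · exact hT.eq_of_le hxT hy hxy
    · rcases Finset.mem_union.1 hy with hy | hy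
      · exact (hS.eq_of_le hy hxS hyx).symm
      · exact (hT.eq_of_le hy hxT hyx).symm
  have h5 := Finset.card_le_card h3
  have h6 := Finset.card_le_card h4
  have h7 := Finset.card_union_add_card_inter S T
  have h8 := Finset.card_union_add_card_inter (join le S T) (join (fun a b => le b a) S T)
  have h9 := hS.card_eq
  have h10 := hT.card_eq
  exact ⟨join_subset hS hT, fun ha hb => join_antichain ha hb, by omega, hS.card_le⟩

lemma dom_join (hle : IsOrder le) (hS : IsMaxAntichain le W k S)
    (hT : IsMaxAntichain le W k T) : Dom le S (join le S T) := by
  intro a ha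
  by_cases hn : ∃ b ∈ T, le a b
  · obtain ⟨b, hb, hab⟩ := hn
    refine ⟨b, Finset.mem_filter.2 ⟨Finset.mem_union_right _ hb, fun y hy hby => ?_⟩, hab⟩
    rcases Finset.mem_union.1 hy with hy | hy
    · obtain rfl := hS.eq_of_le ha hy (hle.trans hab hby)
      exact hle.antisymm hby hab
    · exact hT.eq_of_le hb hy hby
  · refine ⟨a, Finset.mem_filter.2 ⟨Finset.mem_union_left _ ha, fun y hy hay => ?_⟩, hle.refl a⟩
    rcases Finset.mem_union.1 hy with hy | hy
    · exact hS.eq_of_le ha hy hay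
    · exact absurd ⟨y, hy, hay⟩ hn

lemma join_dom (h1 : Dom le S U) (h2 : Dom le T U) : Dom le (join le S T) U := by
  intro a ha
  rcases Finset.mem_union.1 (Finset.mem_filter.1 ha).1 with ha | ha
  · exact h1 a ha
  · exact h2 a ha

lemma comparable_join (hle : IsOrder le) (hS : IsMaxAntichain le W k S)
    (hT : IsMaxAntichain le W k T) (h1 : Dom le U S ∨ Dom le S U) (h2 : Dom le U T ∨ Dom le T U) :
    Dom le U (join le S T) ∨ Dom le (join le S T) U := by
  rcases h1 with h1 | h1
  · exact Or.inl (h1.trans hle (dom_join hle hS hT))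
  rcases h2 with h2 | h2
  · rw [join_comm]
    exact Or.inl (h2.trans hle (dom_join hle hT hS))
  · exact Or.inr (join_dom h1 h2)

/-- A maximum antichain containing `v` can be chosen comparable to all members of a given finite
chain of maximum antichains: replace it by its join or meet with one member after the other. -/
lemma exists_comparable_of_mem (hle : IsOrder le) (F : Finset (Finset X))
    (hF : ∀ S ∈ F, IsMaxAntichain le W k S)
    (hch : ∀ S ∈ F, ∀ T ∈ F, Dom le S T ∨ Dom le T S) {v : X} (hT : IsMaxAntichain le W k T)
    (hv : v ∈ T) :
    ∃ D, v ∈ D ∧ IsMaxAntichain le W k D ∧ ∀ S ∈ F, Dom le S D ∨ Dom le D S := by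
  induction F using Finset.induction_on with
  | empty => exact ⟨T, hv, hT, by simp⟩
  | insert S F _ ih =>
    obtain ⟨D, hvD, hD, hDF⟩ := ih (fun S' h' => hF S' (Finset.mem_insert_of_mem h'))
      fun S' h' T' h'' => hch S' (Finset.mem_insert_of_mem h') T' (Finset.mem_insert_of_mem h'')
    have hS := hF S (Finset.mem_insert_self _ _)
    have hSF : ∀ S' ∈ F, Dom le S' S ∨ Dom le S S' := fun S' h' =>
      hch S' (Finset.mem_insert_of_mem h') S (Finset.mem_insert_self _ _)
    by_cases hup : ∀ a ∈ S, le v a → v = a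
    · refine ⟨join le D S, Finset.mem_filter.2 ⟨Finset.mem_union_left _ hvD, fun y hy hvy => ?_⟩,
        isMaxAntichain_join hle hD hS, fun S' h' => ?_⟩
      · rcases Finset.mem_union.1 hy with hy | hy
        · exact hD.eq_of_le hvD hy hvy
        · exact hup y hy hvy
      · rcases Finset.mem_insert.1 h' with rfl | h'
        · rw [join_comm]
          exact Or.inl (dom_join hle hS hD)
        · exact comparable_join hle hD hS (hDF S' h') (hSF S' h')
    · push Not at hup
      obtain ⟨a, ha, hva, hne⟩ := hup
      have hmeet := isMaxAntichain_join hle.flip hD.flip hS.flip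
      have hback : ∀ {A B : Finset X}, IsMaxAntichain le W k A → IsMaxAntichain le W k B →
          (Dom le A B ∨ Dom le B A) →
          Dom (fun a b => le b a) A B ∨ Dom (fun a b => le b a) B A := fun hA hB hAB =>
        hAB.symm.imp (dom_flip hle hB hA) (dom_flip hle hA hB)
      have hforth : ∀ {A B : Finset X}, IsMaxAntichain le W k A → IsMaxAntichain le W k B →
          (Dom (fun a b => le b a) A B ∨ Dom (fun a b => le b a) B A) →
          Dom le A B ∨ Dom le B A := fun hA hB hAB =>
        hAB.symm.imp (dom_flip hle.flip hB.flip hA.flip) (dom_flip hle.flip hA.flip hB.flip)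
      refine ⟨join (fun a b => le b a) D S, Finset.mem_filter.2
        ⟨Finset.mem_union_left _ hvD, fun y hy hyv => ?_⟩, hmeet.flip, fun S' h' => ?_⟩
      · rcases Finset.mem_union.1 hy with hy | hy
        · exact (hD.eq_of_le hy hvD hyv).symm
        · obtain rfl := hS.eq_of_le hy ha (hle.trans hyv hva)
          exact absurd (hle.antisymm hva hyv) hne
      · refine hforth (hF S' h') hmeet.flip ?_
        rcases Finset.mem_insert.1 h' with rfl | h'
        · rw [join_comm]
          exact Or.inl (dom_join hle.flip hS.flip hD.flip)
        · have h'' := hF S' (Finset.mem_insert_of_mem h')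
          exact comparable_join hle.flip hD.flip hS.flip (hback h'' hD (hDF S' h'))
            (hback h'' hS (hSF S' h'))

/-- Hall's condition holds between two comparable maximum antichains. -/
lemma exists_matching (hle : IsOrder le) (hS : IsMaxAntichain le W k S)
    (hT : IsMaxAntichain le W k T) (h : Dom le S T) :
    ∃ φ : X → X, Set.InjOn φ S ∧ ∀ x ∈ S, φ x ∈ T ∧ le x (φ x) := by
  have hall := (Finset.all_card_le_biUnion_card_iff_exists_injective
    (fun a : S => {b ∈ T | le a b})).1 (by
    intro s
    by_contra! hlt
    set N := s.biUnion fun a : S => {b ∈ T | le a b} with hN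
    have hNT : N ⊆ T := by
      intro b hb
      obtain ⟨a, -, hb⟩ := Finset.mem_biUnion.1 hb
      exact (Finset.mem_filter.1 hb).1
    have hnot : ∀ a ∈ s, ∀ b ∈ T, b ∉ N → ¬ le a b := fun a ha b hb hbN hab =>
      hbN (Finset.mem_biUnion.2 ⟨a, ha, Finset.mem_filter.2 ⟨hb, hab⟩⟩)
    have hnot' : ∀ a ∈ s, ∀ b ∈ T, b ∉ N → ¬ le b a := by
      intro a ha b hb hbN hba
      obtain ⟨b', hb', hab'⟩ := h a a.2
      obtain rfl := hT.eq_of_le hb hb' (hle.trans hba hab')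
      exact hnot a ha b hb hbN hab'
    have hdisj : Disjoint (s.map (Function.Embedding.subtype _)) (T \ N) := by
      rw [Finset.disjoint_left]
      intro a ha hb
      obtain ⟨a, ha', rfl⟩ := Finset.mem_map.1 ha
      exact hnot a ha' _ (Finset.mem_sdiff.1 hb).1 (Finset.mem_sdiff.1 hb).2 (hle.refl _)
    have hcard := hS.card_le (s.map (Function.Embedding.subtype _) ∪ (T \ N)) (by
      intro a ha
      rcases Finset.mem_union.1 ha with ha | ha
      · obtain ⟨a, -, rfl⟩ := Finset.mem_map.1 ha
        exact hS.subset _ a.2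
      · exact hT.subset _ (Finset.mem_sdiff.1 ha).1) (by
      intro a ha b hb hab
      rcases Finset.mem_union.1 ha with ha | ha <;> rcases Finset.mem_union.1 hb with hb | hb
      · obtain ⟨a, -, rfl⟩ := Finset.mem_map.1 ha
        obtain ⟨b, -, rfl⟩ := Finset.mem_map.1 hb
        exact hS.eq_of_le a.2 b.2 hab
      · obtain ⟨a, ha', rfl⟩ := Finset.mem_map.1 ha
        exact absurd hab (hnot a ha' b (Finset.mem_sdiff.1 hb).1 (Finset.mem_sdiff.1 hb).2)
      · obtain ⟨b, hb', rfl⟩ := Finset.mem_map.1 hb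
        exact absurd hab (hnot' b hb' a (Finset.mem_sdiff.1 ha).1 (Finset.mem_sdiff.1 ha).2)
      · exact hT.eq_of_le (Finset.mem_sdiff.1 ha).1 (Finset.mem_sdiff.1 hb).1 hab)
    rw [Finset.card_union_of_disjoint hdisj, Finset.card_map,
      Finset.card_sdiff_of_subset hNT] at hcard
    have := Finset.card_le_card hNT
    have := hT.card_eq
    omega)
  obtain ⟨f, hf, hfm⟩ := hall
  refine ⟨fun x => if hx : x ∈ S then f ⟨x, hx⟩ else x, fun x hx y hy hxy => ?_, fun x hx => ?_⟩
  · have hx' : x ∈ S := hx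
    have hy' : y ∈ S := hy
    simp only [hx', hy', dif_pos] at hxy
    exact congrArg Subtype.val (hf hxy)
  · simp only [hx, dif_pos]
    exact Finset.mem_filter.1 (hfm ⟨x, hx⟩)

end IsMaxAntichain

end MaximumAntichains

/-! ### The on-line construction -/

section Online

open scoped Classical

lemma Link.ne {α : Type*} {lt : ℕ → ℕ → Prop} {c : ℕ → ℕ → α → α → Prop} {u v : ℕ} {a b : α}
    (h : Link lt c u v a b) : u ≠ v := by
  cases h with
  | predBase h1 _ => exact h1.1.ne
  | succBase h1 _ => exact h1.1.ne'
  | pred _ h2 _ _ _ => exact h2.ne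
  | succ _ h2 _ _ _ => exact h2.ne'

/-- The relation between two levels depends only on the levels that are not younger than both. -/
lemma Link.congr {α : Type*} {lt lt' : ℕ → ℕ → Prop} {c c' : ℕ → ℕ → α → α → Prop} {n : ℕ}
    (hlt : ∀ u ≤ n, ∀ v ≤ n, lt u v ↔ lt' u v)
    (hc : ∀ u ≤ n, ∀ v ≤ n, ∀ a b, c u v a b ↔ c' u v a b) {u v : ℕ} {a b : α}
    (h : Link lt c u v a b) (hu : u ≤ n) (hv : v ≤ n) : Link lt' c' u v a b := by
  have hpred : ∀ {p v}, v ≤ n → IsPred lt p v → IsPred lt' p v := by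
    intro p v hv ⟨h1, h2, h3⟩
    have hp := h1.le.trans hv
    refine ⟨h1, (hlt p hp v hv).1 h2, fun w hw hwv => ?_⟩
    have hwn := hw.le.trans hv
    exact (h3 w hw ((hlt w hwn v hv).2 hwv)).imp id (hlt w hwn p hp).1
  have hsucc : ∀ {s u}, u ≤ n → IsSucc lt s u → IsSucc lt' s u := by
    intro s u hu ⟨h1, h2, h3⟩
    have hs := h1.le.trans hu
    refine ⟨h1, (hlt u hu s hs).1 h2, fun w hw huw => ?_⟩
    have hwn := hw.le.trans hu
    exact (h3 w hw ((hlt u hu w hwn).2 huw)).imp id (hlt s hs w hwn).1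
  induction h with
  | predBase h1 h2 => exact .predBase (hpred hv h1) ((hc _ hu _ hv _ _).1 h2)
  | succBase h1 h2 => exact .succBase (hsucc hu h1) ((hc _ hu _ hv _ _).1 h2)
  | pred h1 h2 h3 _ h5 ih =>
    have hp := h1.1.le.trans hv
    exact .pred (hpred hv h1) h2 ((hlt _ hu _ hp).1 h3) (ih hu hp) ((hc _ hp _ hv _ _).1 h5)
  | succ h1 h2 h3 h4 _ ih =>
    have hs := h1.1.le.trans hu
    exact .succ (hsucc hu h1) h2 ((hlt _ hs _ hv).1 h3) ((hc _ hu _ hs _ _).1 h4) (ih hs hv)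

/-- First-Fit colouring of a finite clique with forbidden colours. -/
lemma exists_greedy {F : ℕ → Set ℕ} (hF : ∀ a, (F a).Finite) (S : Finset ℕ) :
    ∃ f : ℕ → ℕ, Set.InjOn f S ∧ ∀ a ∈ S, f a ∉ F a ∧
      ∀ i < f a, i ∈ F a ∨ ∃ b ∈ S, f b = i := by
  induction S using Finset.induction_on with
  | empty => exact ⟨id, by simp, by simp⟩
  | insert x S hx ih =>
    obtain ⟨f, hf1, hf2⟩ := ih
    have hex : ∃ i, i ∉ F x ∪ (S.image f : Finset ℕ) :=
      ((hF x).union (Finset.finite_toSet _)).exists_notMem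
    have hi := Nat.find_spec hex
    have hmin : ∀ i < Nat.find hex, i ∈ F x ∪ (S.image f : Finset ℕ) := fun i hi =>
      not_not.1 (Nat.find_min hex hi)
    set i := Nat.find hex
    have hne : ∀ a ∈ S, Function.update f x i a = f a := fun a ha =>
      Function.update_of_ne (by rintro rfl; exact hx ha) _ _
    have hnotmem : ∀ a ∈ S, f a ≠ i := fun a ha he =>
      hi (Or.inr (Finset.mem_coe.2 (Finset.mem_image.2 ⟨a, ha, he⟩)))
    refine ⟨Function.update f x i, ?_, fun a ha => ?_⟩
    · intro a ha b hb hab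
      rcases Finset.mem_insert.1 ha with rfl | ha' <;> rcases Finset.mem_insert.1 hb with rfl | hb'
      · rfl
      · rw [Function.update_self, hne b hb'] at hab
        exact absurd hab.symm (hnotmem b hb')
      · rw [Function.update_self, hne a ha'] at hab
        exact absurd hab (hnotmem a ha')
      · rw [hne a ha', hne b hb'] at hab
        exact hf1 ha' hb' hab
    · rcases Finset.mem_insert.1 ha with rfl | ha'
      · rw [Function.update_self]
        refine ⟨fun h' => hi (Or.inl h'), fun j hj => (hmin j hj).imp id fun h' => ?_⟩
        obtain ⟨b, hb, rfl⟩ := Finset.mem_image.1 (Finset.mem_coe.1 h')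
        exact ⟨b, Finset.mem_insert_of_mem hb, hne b hb⟩
      · rw [hne a ha']
        refine ⟨(hf2 a ha').1, fun j hj => ((hf2 a ha').2 j hj).imp id ?_⟩
        rintro ⟨b, hb, rfl⟩
        exact ⟨b, Finset.mem_insert_of_mem hb, hne b hb⟩

/-- What is recorded when a vertex is presented. -/
structure Record where
  /-- the size of the antichain, which is also the name of the level system it belongs to -/
  k : ℕ
  /-- the antichain of the vertex -/
  A : Finset ℕ
  /-- the First-Fit colours of the copies of the elements of the antichain -/
  col : ℕ → ℕ

/-- The order between the antichains of size `K`. -/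
def LevelLt (le : ℕ → ℕ → Prop) (R : ℕ → Record) (K u v : ℕ) : Prop :=
  (R u).k = K ∧ (R v).k = K ∧ u ≠ v ∧ Dom le (R u).A (R v).A

/-- The strict order between the copies of vertices in the antichains of size `K`. -/
def Linked (le : ℕ → ℕ → Prop) (R : ℕ → Record) (K : ℕ) : ℕ → ℕ → ℕ → ℕ → Prop :=
  Link (LevelLt le R K) (fun u v => Edge le (R u).A (R v).A)

/-- The conditions that the record of the vertex `v` has to satisfy with respect to the previous
records, in the poset with the order `le` on the vertices `0, …, v`: its antichain contains `v`, is
a maximum antichain among the vertices of level at most `k`, and is comparable to the previous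
ones of the same size; the colours of the copies are those of First-Fit. -/
structure IsGood (le : ℕ → ℕ → Prop) (R : ℕ → Record) (v : ℕ) : Prop where
  mem : v ∈ (R v).A
  card : (R v).A.card = (R v).k
  mem_le : ∀ a ∈ (R v).A, a ≤ v ∧ (R a).k ≤ (R v).k
  eq_of_le : ∀ a ∈ (R v).A, ∀ b ∈ (R v).A, le a b → a = b
  width : ∀ k' ≥ (R v).k, ∀ S : Finset ℕ, (∀ u ∈ S, u ≤ v ∧ (R u).k ≤ k') →
    (∀ a ∈ S, ∀ b ∈ S, le a b → a = b) → S.card ≤ k'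
  comparable : ∀ u < v, (R u).k = (R v).k →
    Dom le (R u).A (R v).A ∨ Dom le (R v).A (R u).A
  linked : ∀ a ∈ (R v).A, ∀ u ≤ v, (R u).k = (R v).k → ∀ b ∈ (R u).A,
    (R u).col b = (R v).col a →
      (u = v ∧ b = a) ∨ Linked le R (R v).k u v b a ∨ Linked le R (R v).k v u a b
  greedy : ∀ a ∈ (R v).A, ∀ i < (R v).col a, ∃ u ≤ v, (R u).k = (R v).k ∧ ∃ b ∈ (R u).A,
    (R u).col b = i ∧ ¬ Linked le R (R v).k u v b a ∧ ¬ Linked le R (R v).k v u a b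

lemma Dom.congr {le le' : ℕ → ℕ → Prop} {n : ℕ} (hle : ∀ a ≤ n, ∀ b ≤ n, le a b ↔ le' a b)
    {S T : Finset ℕ} (hS : ∀ a ∈ S, a ≤ n) (hT : ∀ a ∈ T, a ≤ n) :
    Dom le S T ↔ Dom le' S T := by
  refine forall₂_congr fun a ha => exists_congr fun b => and_congr_right fun hb => ?_
  exact hle a (hS a ha) b (hT b hb)

lemma Edge.congr {le le' : ℕ → ℕ → Prop} {n : ℕ} (hle : ∀ a ≤ n, ∀ b ≤ n, le a b ↔ le' a b)
    {S T : Finset ℕ} (hS : ∀ a ∈ S, a ≤ n) (hT : ∀ a ∈ T, a ≤ n) (a b : ℕ) :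
    Edge le S T a b ↔ Edge le' S T a b := by
  refine and_congr_right fun _ => and_congr_right fun _ => exists_congr fun φ =>
    and_congr_right fun _ => and_congr_right fun _ => forall₂_congr fun x hx =>
    and_congr_right fun h => ?_
  exact hle x (hS x hx) _ (hT _ h)

lemma Linked.congr {le le' : ℕ → ℕ → Prop} {R R' : ℕ → Record} {n : ℕ}
    (hle : ∀ a ≤ n, ∀ b ≤ n, le a b ↔ le' a b)
    (hR : ∀ u ≤ n, (R u).k = (R' u).k ∧ (R u).A = (R' u).A)
    (hbd : ∀ u ≤ n, ∀ a ∈ (R u).A, a ≤ n) (K : ℕ) {u v : ℕ} (hu : u ≤ n) (hv : v ≤ n)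
    (a b : ℕ) : Linked le R K u v a b ↔ Linked le' R' K u v a b := by
  have hlt : ∀ u ≤ n, ∀ v ≤ n, LevelLt le R K u v ↔ LevelLt le' R' K u v := by
    intro u hu v hv
    rw [LevelLt, LevelLt, Dom.congr hle (hbd u hu) (hbd v hv), (hR u hu).1, (hR u hu).2,
      (hR v hv).1, (hR v hv).2]
  have hc : ∀ u ≤ n, ∀ v ≤ n, ∀ a b, Edge le (R u).A (R v).A a b ↔
      Edge le' (R' u).A (R' v).A a b := by
    intro u hu v hv a b
    rw [Edge.congr hle (hbd u hu) (hbd v hv), (hR u hu).2, (hR v hv).2]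
  exact ⟨fun h => Link.congr hlt hc h hu hv,
    fun h => Link.congr (fun u hu v hv => (hlt u hu v hv).symm)
      (fun u hu v hv a b => (hc u hu v hv a b).symm) h hu hv⟩

/-- Whether a record is good depends on the past only. -/
lemma IsGood.congr {le le' : ℕ → ℕ → Prop} {R R' : ℕ → Record} {v : ℕ}
    (hle : ∀ a ≤ v, ∀ b ≤ v, le a b ↔ le' a b) (hR : ∀ u ≤ v, R u = R' u)
    (hbd : ∀ u ≤ v, ∀ a ∈ (R u).A, a ≤ v) (h : IsGood le R v) : IsGood le' R' v := by
  have hv := hR v le_rfl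
  have hlink : ∀ (K : ℕ) {x y : ℕ}, x ≤ v → y ≤ v → ∀ a b,
      (Linked le R K x y a b ↔ Linked le' R' K x y a b) := fun K x y hx hy a b =>
    Linked.congr hle (fun u hu => by rw [hR u hu]; exact ⟨rfl, rfl⟩) hbd K hx hy a b
  refine ⟨hv ▸ h.mem, hv ▸ h.card, fun a ha => ?_, fun a ha b hb hab => ?_,
    fun k' hk' S hS hac => ?_, fun u hu hk => ?_, fun a ha u hu hk b hb hcol => ?_,
    fun a ha i hi => ?_⟩
  · rw [← hv] at ha
    have h1 := h.mem_le a ha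
    rw [← hv, ← hR a h1.1]
    exact h1
  · rw [← hv] at ha hb
    exact h.eq_of_le a ha b hb ((hle a (hbd v le_rfl a ha) b (hbd v le_rfl b hb)).2 hab)
  · rw [← hv] at hk'
    refine h.width k' hk' S (fun u hu => ?_) fun a ha b hb hab =>
      hac a ha b hb ((hle a (hS a ha).1 b (hS b hb).1).1 hab)
    rw [hR u (hS u hu).1]
    exact hS u hu
  · rw [← hR u hu.le, ← hv] at hk ⊢
    rw [← Dom.congr hle (hbd u hu.le) (hbd v le_rfl), ← Dom.congr hle (hbd v le_rfl) (hbd u hu.le)]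
    exact h.comparable u hu hk
  · rw [← hv] at ha hcol hk ⊢
    rw [← hR u hu] at hk hb hcol
    rw [← hlink _ hu le_rfl, ← hlink _ le_rfl hu]
    exact h.linked a ha u hu hk b hb hcol
  · rw [← hv] at ha hi ⊢
    obtain ⟨u, hu, hk, b, hb, hcol, h1, h2⟩ := h.greedy a ha i hi
    rw [hlink _ hu le_rfl] at h1
    rw [hlink _ le_rfl hu] at h2
    rw [hR u hu] at hk hb hcol
    exact ⟨u, hu, hk, b, hb, hcol, h1, h2⟩

/-- Every vertex can be recorded. The size `k` of its antichain is the least number such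
that the vertices of level at most `k'` have width at most `k'` for all `k' ≥ k`; then there is
an antichain of this size that contains the new vertex. -/
lemma exists_isGood {le : ℕ → ℕ → Prop} (hle : IsOrder le) {R : ℕ → Record} {v : ℕ}
    (hgood : ∀ u < v, IsGood le R u) : ∃ r, IsGood le (Function.update R v r) v := by
  let W : ℕ → Set ℕ := fun k' => {u | u = v ∨ (u < v ∧ (R u).k ≤ k')}
  have hWle : ∀ {k' u}, u ∈ W k' → u ≤ v := by
    rintro k' u (rfl | ⟨hu, -⟩)
    · exact le_rfl
    · exact hu.le
  have hex : ∃ k, ∀ k' ≥ k, ∀ S : Finset ℕ, (∀ u ∈ S, u ∈ W k') →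
      (∀ a ∈ S, ∀ b ∈ S, le a b → a = b) → S.card ≤ k' := by
    refine ⟨v + 1, fun k' hk' S hS _ => le_trans ?_ hk'⟩
    refine (Finset.card_le_card (t := Finset.range (v + 1)) fun u hu => ?_).trans
      (Finset.card_range _).le
    exact Finset.mem_range.2 (Nat.lt_succ_of_le (hWle (hS u hu)))
  have hk := Nat.find_spec hex
  have hmin : ∀ j < Nat.find hex, _ := fun j hj => Nat.find_min hex hj
  set k := Nat.find hex
  have hk0 : k ≠ 0 := by
    intro h0
    have := hk 0 (by omega) {v} (by simp [W]) (by simp)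
    simp at this
  obtain ⟨T, hT, hvT⟩ : ∃ T, IsMaxAntichain le (W k) k T ∧ v ∈ T := by
    have h1 := hmin (k - 1) (by omega)
    push Not at h1
    obtain ⟨k', hk', S, hS, hac, hcard⟩ := h1
    have hkk : k' = k - 1 := by
      by_contra hne
      exact absurd (hk k' (by omega) S hS hac) (by omega)
    subst hkk
    have hSk : ∀ u ∈ S, u ∈ W k := fun u hu => (hS u hu).imp id
      fun h2 => ⟨h2.1, h2.2.trans (Nat.sub_le k 1)⟩
    have h2 := hk k le_rfl S hSk hac
    refine ⟨S, ⟨hSk, fun ha hb hab => hac _ ha _ hb hab, by omega,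
      fun T' h3 h4 => hk k le_rfl T' h3 h4⟩, ?_⟩
    by_contra hvS
    have hS' : ∀ u ∈ S, u < v ∧ (R u).k ≤ k - 1 := fun u hu =>
      (hS u hu).resolve_left fun he => hvS (he ▸ hu)
    have hne : S.Nonempty := Finset.card_pos.1 (by omega)
    have h3 := hS' _ (S.max'_mem hne)
    exact absurd ((hgood _ h3.1).width (k - 1) h3.2 S
      (fun u hu => ⟨S.le_max' u hu, (hS' u hu).2⟩) hac) (by omega)
  have hmax : ∀ u < v, (R u).k = k → IsMaxAntichain le (W k) k (R u).A := fun u hu huk =>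
    ⟨fun a ha => Or.inr ⟨((hgood u hu).mem_le a ha).1.trans_lt hu,
      huk ▸ ((hgood u hu).mem_le a ha).2⟩, fun ha hb hab => (hgood u hu).eq_of_le _ ha _ hb hab,
      huk ▸ (hgood u hu).card, fun T' h3 h4 => hk k le_rfl T' h3 h4⟩
  obtain ⟨D, hvD, hD, hDc⟩ := IsMaxAntichain.exists_comparable_of_mem hle
    ({u ∈ Finset.range v | (R u).k = k}.image fun u => (R u).A) (by
      intro S hS
      obtain ⟨u, hu, rfl⟩ := Finset.mem_image.1 hS
      obtain ⟨hu1, hu2⟩ := Finset.mem_filter.1 hu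
      exact hmax u (Finset.mem_range.1 hu1) hu2) (by
      intro S hS S' hS'
      obtain ⟨u, hu, rfl⟩ := Finset.mem_image.1 hS
      obtain ⟨u', hu', rfl⟩ := Finset.mem_image.1 hS'
      obtain ⟨hu1, hu2⟩ := Finset.mem_filter.1 hu
      obtain ⟨hu1', hu2'⟩ := Finset.mem_filter.1 hu'
      rcases lt_trichotomy u u' with hlt | rfl | hlt
      · exact (hgood u' (Finset.mem_range.1 hu1')).comparable u hlt (hu2.trans hu2'.symm)
      · exact Or.inl fun a ha => ⟨a, ha, hle.refl a⟩
      · exact ((hgood u (Finset.mem_range.1 hu1)).comparable u' hlt (hu2'.trans hu2.symm)).symm)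
    hT hvT
  -- the order between the copies does not depend on the colours still to be chosen
  let R₀ : ℕ → Record := Function.update R v ⟨k, D, fun _ => 0⟩
  have hfin : ∀ a, {i | ∃ u < v, (R u).k = k ∧ ∃ b ∈ (R u).A, (R u).col b = i ∧
      ¬ Linked le R₀ k u v b a ∧ ¬ Linked le R₀ k v u a b}.Finite := by
    intro a
    refine (Finset.finite_toSet ((Finset.range v).biUnion fun u =>
      (R u).A.image (R u).col)).subset ?_
    rintro i ⟨u, hu, -, b, hb, rfl, -⟩
    exact Finset.mem_coe.2 (Finset.mem_biUnion.2
      ⟨u, Finset.mem_range.2 hu, Finset.mem_image_of_mem _ hb⟩)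
  obtain ⟨f, hf1, hf2⟩ := exists_greedy hfin D
  refine ⟨⟨k, D, f⟩, ?_⟩
  have hv : Function.update R v ⟨k, D, f⟩ v = ⟨k, D, f⟩ := Function.update_self _ _ _
  have hne : ∀ u < v, Function.update R v ⟨k, D, f⟩ u = R u := fun u hu =>
    Function.update_of_ne hu.ne _ _
  have hlink : ∀ {x y : ℕ}, x ≤ v → y ≤ v → ∀ a b,
      (Linked le (Function.update R v ⟨k, D, f⟩) k x y a b ↔ Linked le R₀ k x y a b) := by
    intro x y hx hy a b
    refine Linked.congr (fun a _ b _ => Iff.rfl) (fun u hu => ?_) (fun u hu a ha => ?_) k hx hy a b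
    · rcases hu.eq_or_lt with rfl | hu
      · simp only [R₀, Function.update_self, and_self]
      · simp only [R₀, Function.update_of_ne hu.ne, and_self]
    · rcases hu.eq_or_lt with rfl | hu
      · rw [hv] at ha
        exact hWle (hD.subset a ha)
      · rw [hne u hu] at ha
        exact ((hgood u hu).mem_le a ha).1.trans hu.le
  have hWk : ∀ {k' u}, k ≤ k' → u ≤ v → (Function.update R v ⟨k, D, f⟩ u).k ≤ k' → u ∈ W k' := by
    intro k' u hk' hu huk
    rcases hu.eq_or_lt with rfl | hu
    · exact Or.inl rfl
    · rw [hne u hu] at huk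
      exact Or.inr ⟨hu, huk⟩
  constructor <;> rw [hv]
  · exact hvD
  · exact hD.card_eq
  · intro a ha
    rcases hD.subset a ha with rfl | ⟨h1, h2⟩
    · exact ⟨le_rfl, by rw [hv]⟩
    · exact ⟨h1.le, by rw [hne a h1]; exact h2⟩
  · exact fun a ha b hb => hD.eq_of_le ha hb
  · exact fun k' hk' S hS hac => hk k' hk' S (fun u hu => hWk hk' (hS u hu).1 (hS u hu).2) hac
  · intro u hu huk
    rw [hne u hu] at huk ⊢
    exact hDc _ (Finset.mem_image.2 ⟨u, Finset.mem_filter.2 ⟨Finset.mem_range.2 hu, huk⟩, rfl⟩)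
  · intro a ha u hu huk b hb hcol
    rw [hlink hu le_rfl, hlink le_rfl hu]
    rcases hu.eq_or_lt with rfl | hu
    · rw [hv] at hb hcol
      exact Or.inl ⟨rfl, hf1 hb ha hcol⟩
    · rw [hne u hu] at hb hcol huk
      by_contra! hn
      exact (hf2 a ha).1 ⟨u, hu, huk, b, hb, hcol, hn.2.1, hn.2.2⟩
  · intro a ha i hi
    rcases (hf2 a ha).2 i hi with ⟨u, hu, huk, b, hb, hcol, h1, h2⟩ | ⟨b, hb, rfl⟩
    · refine ⟨u, hu.le, ?_, b, ?_, ?_, ?_, ?_⟩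
      · rwa [hne u hu]
      · rwa [hne u hu]
      · rwa [hne u hu]
      · rwa [hlink hu.le le_rfl]
      · rwa [hlink le_rfl hu.le]
    · refine ⟨v, le_rfl, by rw [hv], b, by rwa [hv], by rw [hv], ?_, ?_⟩
      · exact fun h => Link.ne h rfl
      · exact fun h => Link.ne h rfl

/-- The restriction of a relation to the vertices `0, …, v`. -/
def truncate (le : ℕ → ℕ → Prop) (v a b : ℕ) : Prop := a ≤ v ∧ b ≤ v ∧ le a b

/-- A good record for the vertex `v`, given the records of the previous vertices. -/
noncomputable def nextRecord (le : ℕ → ℕ → Prop) (v : ℕ) (R : ℕ → Record) : Record :=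
  if h : ∃ r, IsGood le (Function.update R v r) v then h.choose else ⟨0, ∅, fun _ => 0⟩

/-- The records made on-line: the one of `v` is a function of the order on the
vertices `0, …, v`. -/
noncomputable def record (le : ℕ → ℕ → Prop) (v : ℕ) : Record :=
  nextRecord (truncate le v) v fun u => if u < v then record le u else ⟨0, ∅, fun _ => 0⟩
  termination_by v

lemma record_congr {le le' : ℕ → ℕ → Prop} {v : ℕ} (hle : ∀ a ≤ v, ∀ b ≤ v, le a b ↔ le' a b) :
    record le v = record le' v := by
  induction v using Nat.strong_induction_on with
  | _ v ih =>
    rw [record, record]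
    congr 1
    · funext a b
      by_cases ha : a ≤ v <;> by_cases hb : b ≤ v <;> simp [truncate, ha, hb]
      exact hle a ha b hb
    · funext u
      split_ifs with hu
      · exact ih u hu fun a ha b hb => hle a (ha.trans hu.le) b (hb.trans hu.le)
      · rfl

theorem isGood_record {le : ℕ → ℕ → Prop} (hle : IsOrder le) (v : ℕ) :
    IsGood le (record le) v := by
  induction v using Nat.strong_induction_on with
  | _ v ih =>
    have htr : ∀ a ≤ v, ∀ b ≤ v, le a b ↔ truncate le v a b := fun a ha b hb => by
      simp [truncate, ha, hb]
    set R : ℕ → Record := fun u => if u < v then record le u else ⟨0, ∅, fun _ => 0⟩ with hR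
    have hRu : ∀ u < v, R u = record le u := fun u hu => if_pos hu
    have hbd : ∀ u < v, ∀ a ∈ (record le u).A, a ≤ u := fun u hu a ha => ((ih u hu).mem_le a ha).1
    have hRgood : ∀ u < v, IsGood le R u := by
      intro u hu
      refine (ih u hu).congr (fun _ _ _ _ => Iff.rfl)
        (fun u' hu' => (hRu u' (hu'.trans_lt hu)).symm) fun u' hu' a ha => ?_
      exact (hbd u' (hu'.trans_lt hu) a ha).trans hu'
    have hex : ∃ r, IsGood (truncate le v) (Function.update R v r) v := by
      obtain ⟨r, hr⟩ := exists_isGood hle hRgood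
      refine ⟨r, hr.congr htr (fun _ _ => rfl) fun u hu a ha => ?_⟩
      rcases hu.eq_or_lt with rfl | hu
      · exact (hr.mem_le a ha).1
      · rw [Function.update_of_ne hu.ne, hRu u hu] at ha
        exact (hbd u hu a ha).trans hu.le
    have hrec : record le v = hex.choose := by
      rw [record, nextRecord, dif_pos hex]
    have hgood := hex.choose_spec
    rw [← hrec] at hgood
    refine hgood.congr (fun a ha b hb => (htr a ha b hb).symm) (fun u hu => ?_) fun u hu a ha => ?_
    · rcases hu.eq_or_lt with rfl | hu
      · rw [Function.update_self]
      · rw [Function.update_of_ne hu.ne, hRu u hu]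
    · rcases hu.eq_or_lt with rfl | hu
      · exact (hgood.mem_le a ha).1
      · rw [Function.update_of_ne hu.ne, hRu u hu] at ha
        exact (hbd u hu a ha).trans hu.le

end Online

/-! ### The algorithm and the number of its chains -/

section Algorithm

open scoped Classical

lemma isMaxAntichain_record {le : ℕ → ℕ → Prop} (hle : IsOrder le) (u : ℕ) :
    IsMaxAntichain le {a | (record le a).k ≤ (record le u).k} (record le u).k (record le u).A where
  subset a ha := ((isGood_record hle u).mem_le a ha).2
  eq_of_le ha hb hab := (isGood_record hle u).eq_of_le _ ha _ hb hab
  card_eq := (isGood_record hle u).card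
  card_le T hT hac := by
    rcases T.eq_empty_or_nonempty with rfl | hne
    · simp
    · exact (isGood_record hle _).width _ (hT _ (T.max'_mem hne)) T
        (fun a ha => ⟨T.le_max' a ha, hT a ha⟩) hac

/-- The antichains of size `K` form a level system. -/
lemma isLevelSystem_record {le : ℕ → ℕ → Prop} (hle : IsOrder le) (K : ℕ) :
    IsLevelSystem {u | (record le u).k = K} (LevelLt le (record le) K)
      (fun u v => Edge le (record le u).A (record le v).A) (fun u => (record le u).A) K := by
  have hmax : ∀ {u}, (record le u).k = K →
      IsMaxAntichain le {a | (record le a).k ≤ K} K (record le u).A := by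
    rintro u rfl
    exact isMaxAntichain_record hle u
  have hne : ∀ {u v}, u < v → (record le u).A ≠ (record le v).A := by
    intro u v huv he
    have h1 := (isGood_record hle v).mem
    rw [← he] at h1
    exact absurd ((isGood_record hle u).mem_le v h1).1 huv.not_ge
  refine ⟨fun h => h.1, fun h => h.2.1, fun u h => h.2.2.1 rfl, ?_, ?_, fun hu =>
    (hmax hu).card_eq, fun h => ⟨h.1, h.2.1⟩, fun _ _ h1 h2 => h1.comp hle h2, ?_, ?_⟩
  · rintro u v t ⟨hu, hv, huv, h1⟩ ⟨-, ht, -, h2⟩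
    refine ⟨hu, ht, ?_, h1.trans hle h2⟩
    rintro rfl
    have he := (hmax hu).eq_of_dom hle (hmax hv) h1 h2
    rcases lt_or_gt_of_ne huv with h3 | h3
    · exact hne h3 he
    · exact hne h3 he.symm
  · intro u v hu hv huv
    have h1 : (record le u).k = K := hu
    have h2 : (record le v).k = K := hv
    rcases lt_or_gt_of_ne huv with h3 | h3
    · exact ((isGood_record hle v).comparable u h3 (h1.trans h2.symm)).imp
        (fun h => ⟨h1, h2, huv, h⟩) fun h => ⟨h2, h1, huv.symm, h⟩
    · exact ((isGood_record hle u).comparable v h3 (h2.trans h1.symm)).symm.imp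
        (fun h => ⟨h1, h2, huv, h⟩) fun h => ⟨h2, h1, huv.symm, h⟩
  · rintro u v a b - ⟨ha, hb, φ, h1, h2, h3⟩
    exact ⟨φ, h1, h2, fun x hx => ⟨hx, (h3 x hx).1, φ, rfl, h2, h3⟩⟩
  · rintro u v ⟨hu, hv, -, h⟩
    obtain ⟨φ, h2, h3⟩ := (hmax hu).exists_matching hle (hmax hv) h
    exact ⟨φ, h2, fun x hx => ⟨hx, (h3 x hx).1, φ, rfl, h2, h3⟩⟩

lemma Linked.rel {le : ℕ → ℕ → Prop} (hle : IsOrder le) {R : ℕ → Record} {K u v a b : ℕ}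
    (h : Linked le R K u v a b) : le a b := by
  induction h with
  | predBase _ h2 => exact h2.rel
  | succBase _ h2 => exact h2.rel
  | pred _ _ _ _ h5 ih => exact hle.trans ih h5.rel
  | succ _ _ _ h4 _ ih => exact hle.trans h4.rel ih

/-- The vertex `v` is compared to others through its own copy, the element `v` of the level `v`. -/
lemma rel_of_record_eq {le : ℕ → ℕ → Prop} (hle : IsOrder le) {u v : ℕ}
    (hk : (record le u).k = (record le v).k)
    (hcol : (record le u).col u = (record le v).col v) : le u v ∨ le v u := by
  wlog huv : u ≤ v generalizing u v
  · exact (this hk.symm hcol.symm (le_of_not_ge huv)).symm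
  rcases (isGood_record hle v).linked v (isGood_record hle v).mem u huv hk u
    (isGood_record hle u).mem hcol with ⟨rfl, -⟩ | h | h
  · exact Or.inl (hle.refl u)
  · exact Or.inl (h.rel hle)
  · exact Or.inr (h.rel hle)

lemma record_k_pos {le : ℕ → ℕ → Prop} (hle : IsOrder le) (v : ℕ) : 1 ≤ (record le v).k := by
  rw [← (isGood_record hle v).card]
  exact Finset.card_pos.2 ⟨v, (isGood_record hle v).mem⟩

/-- First-Fit on the copies of the vertices in the antichains of one size uses few colours. -/
lemma record_col_le {le : ℕ → ℕ → Prop} (hle : IsOrder le) {v j : ℕ}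
    (hj : (record le v).k < 2 ^ j) : (record le v).col v ≤
      ((record le v).k - 1) * (32 * (record le v).k ^ 3 * (2 * (record le v).k ^ 2)) ^ j := by
  have hs := isLevelSystem_record hle (record le v).k
  obtain ⟨cov, hcov⟩ := Node.exists_cover hs (v + 1)
  have h1 := record_k_pos hle v
  have hk : ∀ x : Node hs (v + 1), (record le x.lev).k = (record le v).k := fun x => x.lev_mem
  refine firstFit_color_le hcov (m := 2 * (record le v).k ^ 2)
    (by have := Nat.one_le_pow 2 _ h1; omega)
    (fun T hT => Node.card_ladder_le hT) (g := fun x => (record le x.lev).col x.el) ?_ ?_ hj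
    ⟨v, v, Nat.lt_succ_self v, rfl, (isGood_record hle v).mem⟩
  · intro x y hxy
    wlog h : x.lev ≤ y.lev generalizing x y
    · exact (this y x hxy.symm (le_of_not_ge h)).symm
    have hky := hk y
    have h3 := (isGood_record hle y.lev).linked y.el y.el_mem x.lev h ((hk x).trans hky.symm)
      x.el x.el_mem hxy
    rw [hky] at h3
    rcases h3 with h3 | h3 | h3
    · exact Or.inl (Or.inl (Node.ext_iff'.2 h3))
    · exact Or.inl (Or.inr h3)
    · exact Or.inr (Or.inr h3)
  · intro x i hi
    have hkx := hk x
    obtain ⟨u, hu, huk, b, hb, hcol, h3, h4⟩ := (isGood_record hle x.lev).greedy x.el x.el_mem i hi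
    rw [hkx] at h3 h4 huk
    have hne : ¬ (u = x.lev ∧ b = x.el) := by
      rintro ⟨rfl, rfl⟩
      exact hi.ne' hcol
    refine ⟨⟨u, b, hu.trans_lt x.lev_lt, huk, hb⟩, hcol,
      fun h5 => h5.elim (fun he => hne (Node.ext_iff'.1 he)) h3,
      fun h5 => h5.elim (fun he => hne (Node.ext_iff'.1 he.symm)) h4⟩

/-- The order on `ℕ` that extends an order on the first vertices, all others being isolated. -/
def extend {n : ℕ} (le : Fin n → Fin n → Prop) (a b : ℕ) : Prop :=
  a = b ∨ ∃ (ha : a < n) (hb : b < n), le ⟨a, ha⟩ ⟨b, hb⟩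

/-- The rule that assigns the vertex `i` to the chain given by the size of its antichain and
by the colour of its own copy. -/
noncomputable def antichainRule : Rule := fun i po =>
  Nat.pair (record (extend po.le) i).k ((record (extend po.le) i).col i)

section Presentation

variable {V : Type u} [PartialOrder V] (p : Presentation V)

/-- The order of the presented poset, transferred to `ℕ`. -/
abbrev Presentation.rel : ℕ → ℕ → Prop := extend fun a b : Fin p.n => p.v a ≤ p.v b

lemma Presentation.isOrder_rel : IsOrder p.rel where
  refl a := Or.inl rfl
  trans := by
    rintro a b d (rfl | ⟨ha, hb, hab⟩) (rfl | ⟨hb', hd, hbd⟩)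
    · exact Or.inl rfl
    · exact Or.inr ⟨hb', hd, hbd⟩
    · exact Or.inr ⟨ha, hb, hab⟩
    · exact Or.inr ⟨ha, hd, hab.trans hbd⟩
  antisymm := by
    rintro a b (rfl | ⟨ha, hb, hab⟩) (h | ⟨hb', ha', hba⟩)
    · rfl
    · rfl
    · exact h.symm
    · exact congrArg Fin.val (p.v.injective (le_antisymm hab hba))

/-- The records computed from the poset presented up to the time of `x` are those of the final
poset. -/
lemma antichainRule_index (x : V) : antichainRule.index p x =
    Nat.pair (record p.rel (p.v.symm x)).k ((record p.rel (p.v.symm x)).col (p.v.symm x)) := by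
  have : record (extend (p.upTo (p.v.symm x)).le) (p.v.symm x) =
      record p.rel (p.v.symm x) := by
    refine record_congr fun a ha b hb => or_congr_right ⟨?_, ?_⟩
    · rintro ⟨ha', hb', h⟩
      exact ⟨ha.trans_lt (p.v.symm x).isLt, hb.trans_lt (p.v.symm x).isLt, h⟩
    · rintro ⟨ha', hb', h⟩
      exact ⟨Nat.lt_succ_of_le ha, Nat.lt_succ_of_le hb, h⟩
  rw [Rule.index, antichainRule, this]

lemma Presentation.rel_symm {x y : V} (h : p.rel (p.v.symm x) (p.v.symm y)) : x ≤ y := by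
  rcases h with h | ⟨ha, hb, h⟩
  · exact (p.v.symm.injective (Fin.val_injective h)).le
  · simpa using h

lemma record_k_le_width (x : V) : ((record p.rel (p.v.symm x)).k : ℕ∞) ≤ width V := by
  have hg := isGood_record p.isOrder_rel (p.v.symm x)
  set A := (record p.rel (p.v.symm x)).A with hA
  have hlt : ∀ a ∈ A, a < p.n := fun a ha => (hg.mem_le a ha).1.trans_lt (p.v.symm x).isLt
  let S : Finset V := (A.attachFin hlt).map p.v.toEmbedding
  have hS : IsAntichain (· ≤ ·) (S : Set V) := by
    intro a ha b hb hne hab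
    obtain ⟨a, ha', rfl⟩ := Finset.mem_map.1 (Finset.mem_coe.1 ha)
    obtain ⟨b, hb', rfl⟩ := Finset.mem_map.1 (Finset.mem_coe.1 hb)
    refine hne (congrArg _ (Fin.val_injective (hg.eq_of_le a ((Finset.mem_attachFin _).1 ha') b
      ((Finset.mem_attachFin _).1 hb') ?_)))
    exact Or.inr ⟨a.isLt, b.isLt, hab⟩
  refine le_trans ?_ (le_iSup₂_of_le (S : Set V) hS le_rfl)
  rw [Set.encard_coe_eq_coe_finsetCard, Finset.card_map, Finset.card_attachFin, hA, hg.card]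

end Presentation

/-- The algorithm of `antichainRule`. -/
noncomputable def antichainAlgorithm : Algorithm.{u} where
  rule := antichainRule
  isChain V _ p c := by
    intro x hx y hy _
    have hxy : antichainRule.index p x = antichainRule.index p y := Eq.trans hx hy.symm
    rw [antichainRule_index, antichainRule_index, Nat.pair_eq_pair] at hxy
    exact (rel_of_record_eq p.isOrder_rel hxy.1 hxy.2).imp p.rel_symm p.rel_symm

lemma chiOn_antichainAlgorithm_le {V : Type u} [PartialOrder V] (p : Presentation V) {w j : ℕ}
    (hw : width V ≤ w) (hj : w < 2 ^ j) : antichainAlgorithm.chiOn p ≤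
      (w * ((w - 1) * (32 * w ^ 3 * (2 * w ^ 2)) ^ j + 1) : ℕ) := by
  have hsub : Set.range (antichainAlgorithm.rule.index p) ⊆
      (((Finset.Icc 1 w ×ˢ Finset.range ((w - 1) * (32 * w ^ 3 * (2 * w ^ 2)) ^ j + 1)).image
        fun q => Nat.pair q.1 q.2 : Finset ℕ) : Set ℕ) := by
    rintro _ ⟨x, rfl⟩
    have hk : (record p.rel (p.v.symm x)).k ≤ w :=
      Nat.cast_le.1 ((record_k_le_width p x).trans hw)
    refine Finset.mem_coe.2 (Finset.mem_image.2
      ⟨((record p.rel (p.v.symm x)).k, (record p.rel (p.v.symm x)).col (p.v.symm x)),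
      Finset.mem_product.2 ⟨Finset.mem_Icc.2 ⟨record_k_pos p.isOrder_rel _, hk⟩,
        Finset.mem_range.2 (Nat.lt_succ_of_le ?_)⟩, (antichainRule_index p x).symm⟩)
    refine (record_col_le p.isOrder_rel (hk.trans_lt hj)).trans ?_
    gcongr
  refine (Set.encard_le_encard hsub).trans ?_
  rw [Set.encard_coe_eq_coe_finsetCard]
  refine Nat.cast_le.2 (Finset.card_image_le.trans ?_)
  simp

lemma val_posetsOfWidth_le {w j : ℕ} (hj : w < 2 ^ j) : val (posetsOfWidth.{u} w) ≤
    (w * ((w - 1) * (32 * w ^ 3 * (2 * w ^ 2)) ^ j + 1) : ℕ) :=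
  (iInf_le _ antichainAlgorithm).trans (iSup₂_le fun _ hP => iSup_le fun p =>
    chiOn_antichainAlgorithm_le p (le_of_eq hP) hj)

/-- With `lg w` rounded down, the power of `32 w³ · 2 w² = 2⁶ w⁵` contributes `w ^ (5 lg w)` and a
constant power of `w`. -/
lemma bound_le_rpow {w : ℕ} (hw : 1 ≤ w) :
    ((w * ((w - 1) * (32 * w ^ 3 * (2 * w ^ 2)) ^ (Nat.log 2 w + 1) + 1) : ℕ) : ℝ) ≤
      (w : ℝ) ^ (6.5 * Real.logb 2 (w : ℝ) + 19) := by
  obtain rfl | hw2 := hw.eq_or_lt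
  · simp
  have hw2 : 2 ≤ w := hw2
  set j := Nat.log 2 w with hj
  have h1 : 2 ^ j ≤ w := Nat.pow_log_le_self 2 (by omega)
  have hnat : w * ((w - 1) * (32 * w ^ 3 * (2 * w ^ 2)) ^ (j + 1) + 1) ≤ w ^ (5 * j + 19) := by
    have h2 : 1 ≤ (32 * w ^ 3 * (2 * w ^ 2)) ^ (j + 1) := Nat.one_le_pow _ _ (by positivity)
    calc w * ((w - 1) * (32 * w ^ 3 * (2 * w ^ 2)) ^ (j + 1) + 1)
        ≤ w * ((w - 1) * (32 * w ^ 3 * (2 * w ^ 2)) ^ (j + 1) +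
          (32 * w ^ 3 * (2 * w ^ 2)) ^ (j + 1)) := by gcongr
      _ = w * (w * (32 * w ^ 3 * (2 * w ^ 2)) ^ (j + 1)) := by
        obtain ⟨v, rfl⟩ := Nat.exists_eq_add_of_le hw
        rw [Nat.add_sub_cancel_left]
        ring
      _ = w * w * (2 ^ 6) * ((2 ^ j) ^ 6) * w ^ (5 * j + 5) := by
        rw [show 32 * w ^ 3 * (2 * w ^ 2) = 2 ^ 6 * w ^ 5 by ring, mul_pow,
          show (2 ^ 6) ^ (j + 1) = 2 ^ 6 * (2 ^ j) ^ 6 by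
            rw [← pow_mul, ← pow_mul, ← pow_add]; congr 1; ring]
        ring
      _ ≤ w * w * (w ^ 6) * (w ^ 6) * w ^ (5 * j + 5) := by gcongr
      _ = w ^ (5 * j + 19) := by ring
  have hw1 : (1 : ℝ) ≤ w := by exact_mod_cast hw
  have hlog : (j : ℝ) ≤ Real.logb 2 w := by
    have := Real.natLog_le_logb w 2
    simpa [hj] using this
  calc ((w * ((w - 1) * (32 * w ^ 3 * (2 * w ^ 2)) ^ (j + 1) + 1) : ℕ) : ℝ)
      ≤ ((w ^ (5 * j + 19) : ℕ) : ℝ) := Nat.cast_le.2 hnat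
    _ = (w : ℝ) ^ ((5 * j + 19 : ℕ) : ℝ) := by rw [Real.rpow_natCast]; push_cast; rfl
    _ ≤ (w : ℝ) ^ (6.5 * Real.logb 2 (w : ℝ) + 19) := by
      refine Real.rpow_le_rpow_of_exponent_le hw1 ?_
      push_cast
      have : (0 : ℝ) ≤ j := Nat.cast_nonneg j
      linarith

end Algorithm

end OnlineChain

theorem theorem2 :
    ∃ C : ℝ, ∀ w : ℕ, 1 ≤ w →
      (OnlineChain.val (OnlineChain.posetsOfWidth.{u} w) : ℝ≥0∞) ≤
        ENNReal.ofReal ((w : ℝ) ^ (6.5 * Real.logb 2 (w : ℝ) + C)) := by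
  refine ⟨19, fun w hw => ?_⟩
  have h1 := OnlineChain.val_posetsOfWidth_le.{u} (Nat.lt_pow_succ_log_self one_lt_two w)
  have h2 := OnlineChain.bound_le_rpow hw
  refine (ENat.toENNReal_le.2 h1).trans ?_
  rw [ENat.toENNReal_coe, ← ENNReal.ofReal_natCast]
  exact ENNReal.ofReal_le_ofReal h2
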